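/- Let $\zeta(x)=2x-\sin 2x$ and let $$V(x)=\frac{-32\,\sin x\,\bigl[\zeta(x)^3\cos x-3\zeta(x)^2\sin^3x+\zeta(x)\cos x+\sin^3x\bigr]}{(1+\zeta(x)^2)^2},\qquad x\in\mathbb R,$$ be the one-dimensional Wigner–von Neumann potential (the potential for which $\psi(x)=\sin x/(1+\zeta(x)^2)$ satisfies $-\psi''+V\psi=\psi$). For a mass $m>0$ put $l=-\frac{d^2}{dx^2}+m^2+V$ and let $$h=\begin{pmatrix}0&1\\ l&0\end{pmatrix}\quad\text{on } C_0^\infty(\mathbb R)^2$$ be the Klein–Gordon operator whose only interaction is the scalar potential $q=q_s=V$. Its energy form is $$(f,g)_E=(f_1',g_1')_{L^2}+((m^2+V)f_1,g_1)_{L^2}+(f_2,g_2)_{L^2}.$$ Assume that the energy form is strictly positive, i.e. that for some $\epsilon>0$ $$\|f\|^2\,\epsilon\le\|f'\|^2+\int(m^2+V)|f|^2\,dx\qquad\text{for all } f\in C_0^\infty(\mathbb R),\tag{P}$$ and let $\mathfrak H_E$ be the completion of $C_0^\infty(\mathbb R)^2$ in the norm of $(\cdot,\cdot)_E$. Then: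 * $\mathfrak H_E$ is identified with $H^1(\mathbb R)\oplus L^2(\mathbb R)$ (as a vector space, extending the inclusion of $C_0^\infty(\mathbb R)^2$), with the inner product $(\cdot,\cdot)_E$ computed with weak derivatives; * $h$ has an extension $H_F$ that is self-adjoint in $\mathfrak H_E$, with domain $D(H_F)=H^2(\mathbb R)\oplus H^1(\mathbb R)$, acting by $H_F(f_1,f_2)=(f_2,\,lf_1)$ with weak derivatives; * $H_F$ has eigenvalues embedded in $(-\infty,-m]\cup[m,\infty)$: this set is contained in the spectrum of $H_F$, and $E=\sqrt{1+m^2}$ and $E=-\sqrt{1+m^2}$, which belong to it, are eigenvalues of $H_F$. Moreover, let (I) be the condition that for some $\epsilon>0$, $\int V^-|f|^2\,dx\le\|f'\|^2+(m^2-\epsilon)\|f\|^2$ for all $f\in C_0^\infty(\mathbb R)$, where $V^-=\max(-V,0)$. Condition (I) holds for all sufficiently large $m$, and for every $m>0$ condition (I) implies (P). -/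

import Mathlib

open MeasureTheory
open scoped ComplexConjugate

noncomputable section

namespace KleinGordon

/-- The complex test functions `C₀^∞(ℝ)`. -/
abbrev TestFn : Type := TestFunction (⊤ : TopologicalSpace.Opens ℝ) ℂ ⊤

/-- The Hilbert space `L²(ℝ)` of complex functions. -/
abbrev L2 : Type := Lp ℂ 2 (volume : Measure ℝ)

/-! ### The potential -/

/-- `ζ(x) = 2x - sin 2x`. -/
def zeta (x : ℝ) : ℝ := 2 * x - Real.sin (2 * x)

/-- The one-dimensional Wigner - von Neumann potential. The function `sin x / (1 + ζ(x)²)` solves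
`-ψ'' + V ψ = ψ`. -/
def vWN (x : ℝ) : ℝ :=
  -32 * Real.sin x *
      (zeta x ^ 3 * Real.cos x - 3 * zeta x ^ 2 * Real.sin x ^ 3 + zeta x * Real.cos x
        + Real.sin x ^ 3) /
    (1 + zeta x ^ 2) ^ 2

theorem contDiff_vWN : ContDiff ℝ (⊤ : ℕ∞) vWN := by
  have hz : ContDiff ℝ (⊤ : ℕ∞) zeta := by
    unfold zeta
    fun_prop
  unfold vWN
  refine ContDiff.div (by fun_prop) (by fun_prop) fun x => ?_
  positivity

/-! ### The energy form and its positivity -/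

/-- The condition `∫ q⁻ |f|² ≤ ‖f'‖² + (m² - ε) ‖f‖²` on `C₀^∞(ℝ)`, for some `ε > 0`. -/
def WederI (m : ℝ) (q : ℝ → ℝ) : Prop :=
  ∃ ε : ℝ, 0 < ε ∧ ∀ f : TestFn,
    ∫ x, max (-(q x)) 0 * ‖f x‖ ^ 2 ≤
      (∫ x, ‖deriv f x‖ ^ 2) + (m ^ 2 - ε) * ∫ x, ‖f x‖ ^ 2

/-- Strict positivity of the energy form: `‖f'‖² + ∫ (m² + q) |f|² ≥ ε ‖f‖²` on `C₀^∞(ℝ)`,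
for some `ε > 0`. -/
def EnergyPositive (m : ℝ) (q : ℝ → ℝ) : Prop :=
  ∃ ε : ℝ, 0 < ε ∧ ∀ f : TestFn,
    ε * ∫ x, ‖f x‖ ^ 2 ≤
      (∫ x, ‖deriv f x‖ ^ 2) + ∫ x, (m ^ 2 + q x) * ‖f x‖ ^ 2

/-- The energy sesquilinear form
`(f, g)_E = (f₁', g₁') + ((m² + q) f₁, g₁) + (f₂, g₂)` on pairs of test functions
(conjugate-linear in the first argument). -/
def energyForm (m : ℝ) (q : ℝ → ℝ) (f g : TestFn × TestFn) : ℂ :=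
  (∫ x, conj (deriv f.1 x) * deriv g.1 x)
    + (∫ x, ((m ^ 2 + q x : ℝ) : ℂ) * (conj (f.1 x) * g.1 x))
    + ∫ x, conj (f.2 x) * g.2 x

/-! ### The formal Klein-Gordon operator on pairs of test functions -/

/-- `l f = -f'' + (m² + V) f` on test functions. -/
def lTest (m : ℝ) (f : TestFn) : TestFn where
  toFun x := -deriv (deriv f) x + ((m ^ 2 + vWN x : ℝ) : ℂ) * f x
  contDiff' := by
    have hf : ContDiff ℝ (⊤ : ℕ∞) f := f.contDiff
    have h1 : ContDiff ℝ (⊤ : ℕ∞) (deriv f) := (contDiff_infty_iff_deriv.1 hf).2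
    have h2 : ContDiff ℝ (⊤ : ℕ∞) (deriv (deriv f)) := (contDiff_infty_iff_deriv.1 h1).2
    have h3 : ContDiff ℝ (⊤ : ℕ∞) fun x => ((m ^ 2 + vWN x : ℝ) : ℂ) :=
      Complex.ofRealCLM.contDiff.comp (contDiff_const.add contDiff_vWN)
    exact h2.neg.add (h3.mul hf)
  hasCompactSupport' :=
    (f.hasCompactSupport.deriv.deriv.neg).add (f.hasCompactSupport.mul_left)
  tsupport_subset' := Set.subset_univ _

/-- The operator `h = [[0, 1], [l, 0]]` on `C₀^∞(ℝ)²`, with the pure scalar interaction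
`q = q_s = V`. -/
def hTest (m : ℝ) (f : TestFn × TestFn) : TestFn × TestFn := (f.2, lTest m f.1)

/-! ### The energy space, the completion of `C₀^∞(ℝ)²` in the energy norm -/

/-- `C₀^∞(ℝ)²`, to be equipped with the energy inner product. -/
def TestPairs (m : ℝ) (_hpos : EnergyPositive m vWN) : Type := TestFn × TestFn

theorem integrable_test (c : ℝ → ℂ) (hc : Continuous c) (u v : ℝ → ℂ) (hu : Continuous u)
    (hv : Continuous v) (hv' : HasCompactSupport v) :
    Integrable fun x => c x * (conj (u x) * v x) := by
  refine Continuous.integrable_of_hasCompactSupport (by fun_prop) ?_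
  exact (hv'.mul_left).mul_left

theorem differentiable_test (f : TestFn) : Differentiable ℝ f :=
  f.contDiff.differentiable (by simp)

theorem continuous_deriv_test (f : TestFn) : Continuous (deriv f) :=
  f.contDiff.continuous_deriv (by simp)

theorem deriv_add_test (f g : TestFn) (x : ℝ) : deriv (f + g : TestFn) x = deriv f x + deriv g x :=
  deriv_add (differentiable_test f x) (differentiable_test g x)

theorem deriv_smul_test (c : ℂ) (f : TestFn) (x : ℝ) :
    deriv (c • f : TestFn) x = c * deriv f x :=
  deriv_const_mul c (differentiable_test f x)

theorem continuous_weight (m : ℝ) : Continuous fun x => ((m ^ 2 + vWN x : ℝ) : ℂ) :=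
  Complex.continuous_ofReal.comp (continuous_const.add contDiff_vWN.continuous)

theorem integrable_energy (m : ℝ) (f g : TestFn) :
    Integrable (fun x => conj (deriv f x) * deriv g x) ∧
    Integrable (fun x => ((m ^ 2 + vWN x : ℝ) : ℂ) * (conj (f x) * g x)) ∧
    Integrable (fun x => conj (f x) * g x) := by
  refine ⟨?_, ?_, ?_⟩
  · simpa using integrable_test (fun _ => 1) continuous_const _ _ (continuous_deriv_test f)
      (continuous_deriv_test g) g.hasCompactSupport.deriv
  · exact integrable_test _ (continuous_weight m) _ _ f.continuous g.continuous g.hasCompactSupport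
  · simpa using integrable_test (fun _ => 1) continuous_const _ _ f.continuous
      g.continuous g.hasCompactSupport

theorem energyForm_self (m : ℝ) (f : TestFn × TestFn) :
    energyForm m vWN f f =
      (((∫ x, ‖deriv f.1 x‖ ^ 2) + (∫ x, (m ^ 2 + vWN x) * ‖f.1 x‖ ^ 2)
        + ∫ x, ‖f.2 x‖ ^ 2 : ℝ) : ℂ) := by
  unfold energyForm
  simp only [Complex.conj_mul']
  push_cast
  rw [← integral_complex_ofReal, ← integral_complex_ofReal, ← integral_complex_ofReal]
  push_cast
  rfl

/-- The energy inner product; it is positive definite. -/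
@[reducible]
def energyCore (m : ℝ) (hpos : EnergyPositive m vWN) :
    InnerProductSpace.Core ℂ (TestFn × TestFn) where
  inner f g := energyForm m vWN f g
  conj_inner_symm f g := by
    change conj (energyForm m vWN g f) = energyForm m vWN f g
    unfold energyForm
    simp only [map_add, ← integral_conj, map_mul, Complex.conj_conj, Complex.conj_ofReal]
    simp only [mul_comm]
  re_inner_nonneg f := by
    change 0 ≤ (energyForm m vWN f f).re
    rw [energyForm_self, Complex.ofReal_re]
    obtain ⟨ε, hε, h⟩ := hpos
    have h1 := h f.1
    have h2 : 0 ≤ ε * ∫ x, ‖f.1 x‖ ^ 2 := by positivity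
    have h3 : 0 ≤ ∫ x, ‖f.2 x‖ ^ 2 := by positivity
    linarith
  add_left f g k := by
    change energyForm m vWN ((f.1 + g.1, f.2 + g.2) : TestFn × TestFn) k =
      energyForm m vWN f k + energyForm m vWN g k
    unfold energyForm
    obtain ⟨a1, a2, -⟩ := integrable_energy m f.1 k.1
    obtain ⟨b1, b2, -⟩ := integrable_energy m g.1 k.1
    obtain ⟨-, -, a3⟩ := integrable_energy m f.2 k.2
    obtain ⟨-, -, b3⟩ := integrable_energy m g.2 k.2
    have e1 : ∀ x, (f.1 + g.1 : TestFn) x = f.1 x + g.1 x := fun _ => rfl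
    have e2 : ∀ x, (f.2 + g.2 : TestFn) x = f.2 x + g.2 x := fun _ => rfl
    simp only [deriv_add_test, e1, e2, map_add, add_mul, mul_add]
    rw [integral_add a1 b1, integral_add a2 b2, integral_add a3 b3]
    ring
  smul_left f k c := by
    change energyForm m vWN ((c • f.1, c • f.2) : TestFn × TestFn) k =
      conj c * energyForm m vWN f k
    unfold energyForm
    have e1 : ∀ x, (c • f.1 : TestFn) x = c * f.1 x := fun _ => rfl
    have e2 : ∀ x, (c • f.2 : TestFn) x = c * f.2 x := fun _ => rfl
    simp only [deriv_smul_test, e1, e2, map_mul, mul_add, mul_assoc, mul_left_comm _ (conj c),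
      integral_const_mul]
  definite f hf := by
    change energyForm m vWN f f = 0 at hf
    rw [energyForm_self, Complex.ofReal_eq_zero] at hf
    obtain ⟨ε, hε, h⟩ := hpos
    have h1 := h f.1
    have h2 : 0 ≤ ∫ x, ‖f.1 x‖ ^ 2 := by positivity
    have h3 : 0 ≤ ∫ x, ‖f.2 x‖ ^ 2 := by positivity
    have key : ∀ g : TestFn, ∫ x, ‖g x‖ ^ 2 = 0 → g = 0 := by
      intro g hg
      have hc : Continuous fun x => ‖g x‖ ^ 2 := by fun_prop
      have hi : Integrable fun x => ‖g x‖ ^ 2 := by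
        refine hc.integrable_of_hasCompactSupport ?_
        exact g.hasCompactSupport.norm.comp_left (g := fun t : ℝ => t ^ 2) (by simp)
      have h0 := (integral_eq_zero_iff_of_nonneg (fun x => by positivity) hi).1 hg
      have h0' := (hc.ae_eq_iff_eq volume continuous_const).1 h0
      ext x
      have hx : ‖g x‖ ^ 2 = (0 : ℝ) := congrFun h0' x
      simpa using hx
    refine Prod.ext (key f.1 ?_) (key f.2 ?_) <;> nlinarith

instance (m : ℝ) (hpos : EnergyPositive m vWN) : SeminormedAddCommGroup (TestPairs m hpos) :=
  @InnerProductSpace.Core.toSeminormedAddCommGroup ℂ (TestFn × TestFn) _ _ _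
    (energyCore m hpos).toCore

instance (m : ℝ) (hpos : EnergyPositive m vWN) : InnerProductSpace ℂ (TestPairs m hpos) :=
  @InnerProductSpace.ofCore ℂ (TestFn × TestFn) _ _ _ (energyCore m hpos).toCore

/-- A pair of test functions, seen in the pre-Hilbert space. -/
def TestPairs.equiv (m : ℝ) (hpos : EnergyPositive m vWN) :
    (TestFn × TestFn) ≃ₗ[ℂ] TestPairs m hpos :=
  LinearEquiv.refl ℂ (TestFn × TestFn)

/-- The energy space: the completion of `C₀^∞(ℝ)²` in the energy norm. -/
abbrev EnergySpace (m : ℝ) (hpos : EnergyPositive m vWN) : Type :=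
  UniformSpace.Completion (TestPairs m hpos)

/-- The canonical map of `C₀^∞(ℝ)²` into the energy space. -/
def toEnergy (m : ℝ) (hpos : EnergyPositive m vWN) (f : TestFn × TestFn) : EnergySpace m hpos :=
  (TestPairs.equiv m hpos f : UniformSpace.Completion (TestPairs m hpos))

/-! ### Sobolev spaces through weak derivatives -/

/-- `v` is the weak derivative of `u`. -/
def IsWeakDeriv (u v : L2) : Prop :=
  ∀ φ : TestFn, ∫ x, u x * deriv φ x = -∫ x, v x * φ x

theorem integrable_L2_mul (u : L2) (φ : ℝ → ℂ) (h : Continuous φ) (h' : HasCompactSupport φ) :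
    Integrable fun x => u x * φ x :=
  MemLp.integrable_mul (p := 2) (q := 2) (Lp.memLp u) (h.memLp_of_hasCompactSupport h')

theorem IsWeakDeriv.zero : IsWeakDeriv 0 0 := by
  intro φ
  simp

theorem IsWeakDeriv.add {u v u' v' : L2} (h : IsWeakDeriv u v) (h' : IsWeakDeriv u' v') :
    IsWeakDeriv (u + u') (v + v') := by
  intro φ
  have e0 : (fun x => (u + u') x * deriv φ x) =ᵐ[volume]
      fun x => u x * deriv φ x + u' x * deriv φ x := by
    filter_upwards [Lp.coeFn_add u u'] with x hx
    rw [hx, Pi.add_apply, add_mul]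
  have e1 : (fun x => (v + v') x * φ x) =ᵐ[volume] fun x => v x * φ x + v' x * φ x := by
    filter_upwards [Lp.coeFn_add v v'] with x hx
    rw [hx, Pi.add_apply, add_mul]
  have c := continuous_deriv_test φ
  have s := φ.hasCompactSupport.deriv
  rw [integral_congr_ae e0, integral_congr_ae e1,
    integral_add (integrable_L2_mul u _ c s) (integrable_L2_mul u' _ c s),
    integral_add (integrable_L2_mul v _ φ.continuous φ.hasCompactSupport)
      (integrable_L2_mul v' _ φ.continuous φ.hasCompactSupport), h φ, h' φ]
  ring

theorem IsWeakDeriv.smul (c : ℂ) {u v : L2} (h : IsWeakDeriv u v) :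
    IsWeakDeriv (c • u) (c • v) := by
  intro φ
  have e0 : (fun x => (c • u) x * deriv φ x) =ᵐ[volume] fun x => c * (u x * deriv φ x) := by
    filter_upwards [Lp.coeFn_smul c u] with x hx
    rw [hx, Pi.smul_apply, smul_eq_mul, mul_assoc]
  have e1 : (fun x => (c • v) x * φ x) =ᵐ[volume] fun x => c * (v x * φ x) := by
    filter_upwards [Lp.coeFn_smul c v] with x hx
    rw [hx, Pi.smul_apply, smul_eq_mul, mul_assoc]
  rw [integral_congr_ae e0, integral_congr_ae e1, integral_const_mul, integral_const_mul, h φ]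
  ring

/-- The Sobolev space `H¹(ℝ) = W^{1,2}(ℝ)`. -/
def sobolevH1 : Submodule ℂ L2 where
  carrier := {u | ∃ v, IsWeakDeriv u v}
  zero_mem' := ⟨0, .zero⟩
  add_mem' := fun ⟨v, h⟩ ⟨v', h'⟩ => ⟨v + v', h.add h'⟩
  smul_mem' := fun c _ ⟨v, h⟩ => ⟨c • v, h.smul c⟩

/-- The Sobolev space `H²(ℝ) = W^{2,2}(ℝ)`. -/
def sobolevH2 : Submodule ℂ L2 where
  carrier := {u | ∃ v w, IsWeakDeriv u v ∧ IsWeakDeriv v w}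
  zero_mem' := ⟨0, 0, .zero, .zero⟩
  add_mem' := fun ⟨v, w, h, k⟩ ⟨v', w', h', k'⟩ => ⟨v + v', w + w', h.add h', k.add k'⟩
  smul_mem' := fun c _ ⟨v, w, h, k⟩ => ⟨c • v, c • w, h.smul c, k.smul c⟩

/-! ### The energy space as a space of functions, and the operator -/

/-- `J` identifies `H¹(ℝ) ⊕ L²(ℝ)` with the energy space: it is the inclusion on `C₀^∞(ℝ)²`, and it
carries the energy form on `H¹(ℝ) ⊕ L²(ℝ)`, with weak derivatives, to the inner product. -/
def IsEnergyIdentification (m : ℝ) (hpos : EnergyPositive m vWN)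
    (J : (sobolevH1 × L2) ≃ₗ[ℂ] EnergySpace m hpos) : Prop :=
  (∀ f : TestFn × TestFn, ∃ u : sobolevH1 × L2,
    (u.1 : L2) =ᵐ[volume] f.1 ∧ u.2 =ᵐ[volume] f.2 ∧ J u = toEnergy m hpos f) ∧
  ∀ (u v : sobolevH1 × L2) (u' v' : L2), IsWeakDeriv u.1 u' → IsWeakDeriv v.1 v' →
    inner ℂ (J u) (J v) =
      (∫ x, conj (u' x) * v' x)
        + (∫ x, ((m ^ 2 + vWN x : ℝ) : ℂ) * (conj ((u.1 : L2) x) * (v.1 : L2) x))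
        + ∫ x, conj (u.2 x) * v.2 x

/-- `v = (v₁, v₂)` is the image of `u = (u₁, u₂)`, where `u₁ ∈ H²` and `u₂ ∈ H¹`, under the matrix
`[[0, 1], [l, 0]]` with `l = -d²/dx² + m² + V` in the weak sense. -/
def KGAction (m : ℝ) (u v : sobolevH1 × L2) : Prop :=
  (v.1 : L2) = u.2 ∧ ∃ d w : L2, IsWeakDeriv u.1 d ∧ IsWeakDeriv d w ∧
    v.2 =ᵐ[volume] fun x => -w x + ((m ^ 2 + vWN x : ℝ) : ℂ) * (u.1 : L2) x

/-- `E` is an eigenvalue of `H`. -/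
def IsEigenvalue {K : Type*} [AddCommGroup K] [Module ℂ K] (H : K →ₗ.[ℂ] K) (E : ℂ) : Prop :=
  ∃ x : H.domain, (x : K) ≠ 0 ∧ H x = E • (x : K)

/-- The resolvent set of an unbounded operator: `H - z` is a bijection of its domain onto the space,
with a bounded inverse. -/
def resolventSet {K : Type*} [NormedAddCommGroup K] [InnerProductSpace ℂ K]
    (H : K →ₗ.[ℂ] K) : Set ℂ :=
  {z | ∃ R : K →L[ℂ] K,
    (∀ y : K, ∃ x : H.domain, (x : K) = R y ∧ H x - z • (x : K) = y) ∧
    ∀ x : H.domain, R (H x - z • (x : K)) = x}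

/-- The spectrum of an unbounded operator. -/
def spectrumSet {K : Type*} [NormedAddCommGroup K] [InnerProductSpace ℂ K]
    (H : K →ₗ.[ℂ] K) : Set ℂ :=
  (resolventSet H)ᶜ

end KleinGordon

end

/-!
The energy space is identified by extending the identity of `C₀^∞(ℝ)²` to an isomorphism between two
of its completions. One is the energy space. The other is `H¹ ⊕ L²`, where `H¹` is realized as the
closed graph `weakGraph` of the weak derivative in `L² × L²`. The norms are equivalent on test
functions because `V` is bounded and the energy form is strictly positive
(`exists_norm_toEnergyLinear_le`, `exists_norm_testToPair_le`). Test functions are dense in the graph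
(`denseRange_testToWeakGraph`): a pair `(u, u')` of the graph that is orthogonal to them satisfies
`u'' = u` weakly, hence `u ± u'` solve `z' = ± z`, and these equations have no nonzero solution in
`L²` (`eq_zero_of_isWeakDeriv_smul`). Density also gives the formula for the inner product
(`inner_energyIdent`) and integration by parts in `H¹` (`IsWeakDeriv.inner_eq`).

The operator `kgOp` is defined through its graph. It is symmetric by integration by parts, and it is
surjective, since the Riesz representation theorem in the energy space solves `l u = g` weakly
(`kgOp_surjective`). A densely defined, symmetric and surjective operator is self-adjoint.

With the square integrable function `ψ = sin x / (1 + ζ²)`, for which `-ψ'' + V ψ = ψ`, the pair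
`(ψ, E ψ)` is an eigenvector when `E² = 1 + m²` (`isEigenvalue_kgOp`). For `E² = m² + k²` the wave
packets `φ(x) = χ((x - n²)/n) e^{ikx}` satisfy `‖(l - E²) φ‖ ≤ C ‖φ‖ / n`, because `V` is `O(1/x)`;
the pairs `(φ, E φ)` are then approximate eigenvectors (`exists_approx_solution`,
`mem_spectrumSet_kgOp`).
-/

open MeasureTheory
open scoped ComplexConjugate

noncomputable section

namespace KleinGordon

/-! ### Test functions in `L²` -/

/-- The test function given by a smooth function with compact support. -/
def mkTest (f : ℝ → ℂ) (h : ContDiff ℝ (⊤ : ℕ∞) f) (h' : HasCompactSupport f) : TestFn :=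
  ⟨f, h, h', Set.subset_univ _⟩

/-- A real test function, seen as a complex one. -/
def realTest (g : ℝ → ℝ) (h : ContDiff ℝ (⊤ : ℕ∞) g) (h' : HasCompactSupport g) : TestFn :=
  have c : ContDiff ℝ (⊤ : ℕ∞) fun x => (g x : ℂ) := Complex.ofRealCLM.contDiff.comp h
  have s : HasCompactSupport fun x => (g x : ℂ) :=
    h'.comp_left (g := fun t : ℝ => (t : ℂ)) (by simp)
  mkTest (fun x => (g x : ℂ)) c s

@[simp] theorem realTest_apply (g : ℝ → ℝ) (h : ContDiff ℝ (⊤ : ℕ∞) g)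
    (h' : HasCompactSupport g) (x : ℝ) : realTest g h h' x = g x := rfl

/-- The derivative of a test function, as a linear map. -/
def derivTest : TestFn →ₗ[ℂ] TestFn where
  toFun f :=
    { toFun := deriv f
      contDiff' := (contDiff_infty_iff_deriv.1 f.contDiff).2
      hasCompactSupport' := f.hasCompactSupport.deriv
      tsupport_subset' := Set.subset_univ _ }
  map_add' f g := by ext x; exact deriv_add_test f g x
  map_smul' c f := by ext x; exact deriv_smul_test c f x

@[simp] theorem derivTest_apply (f : TestFn) (x : ℝ) : derivTest f x = deriv f x := rfl

/-- The complex conjugate of a test function. -/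
def conjTest (f : TestFn) : TestFn where
  toFun x := conj (f x)
  contDiff' := Complex.conjCLE.contDiff.comp f.contDiff
  hasCompactSupport' := f.hasCompactSupport.comp_left (g := conj) (by simp)
  tsupport_subset' := Set.subset_univ _

@[simp] theorem conjTest_apply (f : TestFn) (x : ℝ) : conjTest f x = conj (f x) := rfl

@[simp] theorem conjTest_conjTest (f : TestFn) : conjTest (conjTest f) = f := by
  ext x; simp

theorem derivTest_conjTest (f : TestFn) : derivTest (conjTest f) = conjTest (derivTest f) := by
  ext x
  exact ((differentiable_test f x).hasDerivAt.star).deriv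

theorem memLp_test (f : TestFn) : MemLp f 2 (volume : Measure ℝ) :=
  f.continuous.memLp_of_hasCompactSupport f.hasCompactSupport

/-- The inclusion of the test functions in `L²(ℝ)`. -/
def testToL2 : TestFn →ₗ[ℂ] L2 where
  toFun f := (memLp_test f).toLp f
  map_add' _ _ := rfl
  map_smul' _ _ := rfl

theorem coeFn_testToL2 (f : TestFn) : testToL2 f =ᵐ[volume] f := (memLp_test f).coeFn_toLp

theorem inner_L2 (u v : L2) : inner ℂ u v = ∫ x, conj (u x) * v x := by
  simp only [L2.inner_def, RCLike.inner_apply, mul_comm]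

theorem norm_sq_L2 (u : L2) : ‖u‖ ^ 2 = ∫ x, ‖u x‖ ^ 2 := by
  have h : ((‖u‖ ^ 2 : ℝ) : ℂ) = ((∫ x, ‖u x‖ ^ 2 : ℝ) : ℂ) := by
    rw [← integral_complex_ofReal]
    push_cast
    simp only [← Complex.conj_mul']
    rw [← inner_L2]
    simp
  exact_mod_cast h

theorem norm_sq_testToL2 (f : TestFn) : ‖testToL2 f‖ ^ 2 = ∫ x, ‖f x‖ ^ 2 := by
  rw [norm_sq_L2]
  exact integral_congr_ae ((coeFn_testToL2 f).mono fun x hx => by simp only [hx])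

theorem inner_testToL2_left (φ : TestFn) (u : L2) :
    inner ℂ (testToL2 φ) u = ∫ x, conj (φ x) * u x := by
  rw [inner_L2]
  exact integral_congr_ae ((coeFn_testToL2 φ).mono fun x hx => by simp only [hx])

theorem inner_testToL2 (f g : TestFn) :
    inner ℂ (testToL2 f) (testToL2 g) = ∫ x, conj (f x) * g x := by
  rw [inner_testToL2_left]
  exact integral_congr_ae ((coeFn_testToL2 g).mono fun x hx => by simp only [hx])

theorem integral_mul_test (φ : TestFn) (u : L2) :
    ∫ x, u x * φ x = inner ℂ (testToL2 (conjTest φ)) u := by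
  rw [inner_testToL2_left]
  simp [mul_comm]

theorem denseRange_testToL2 : DenseRange testToL2 := by
  refine (Lp.dense_hasCompactSupport_contDiff (F := ℂ) (μ := (volume : Measure ℝ)) (p := 2)
    (by simp)).mono ?_
  rintro u ⟨g, hg, hg', hg''⟩
  refine ⟨⟨g, hg'', hg', Set.subset_univ _⟩, Lp.ext ?_⟩
  exact (coeFn_testToL2 _).trans hg.symm

/-- A locally integrable function that is orthogonal to every test function vanishes. -/
theorem ae_eq_zero_of_integral_mul_test {y : ℝ → ℂ} (hy : LocallyIntegrable y)
    (h : ∀ φ : TestFn, ∫ x, y x * φ x = 0) : ∀ᵐ x, y x = 0 := by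
  refine ae_eq_zero_of_integral_contDiff_smul_eq_zero hy fun g hg hg' => ?_
  have := h (realTest g hg hg')
  simpa [mul_comm] using this

theorem eq_zero_of_inner_test {u : L2} (h : ∀ φ : TestFn, inner ℂ (testToL2 φ) u = 0) : u = 0 :=
  denseRange_testToL2.eq_zero_of_inner_right (𝕜 := ℂ) h

/-! ### Weak derivatives -/

/-- The weak derivative in terms of the inner product of `L²`; the bilinear pairing of the definition
becomes sesquilinear after conjugation of the test function. -/
theorem isWeakDeriv_iff {u v : L2} : IsWeakDeriv u v ↔
    ∀ φ : TestFn, inner ℂ (testToL2 (derivTest φ)) u = -inner ℂ (testToL2 φ) v := by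
  constructor
  · intro h φ
    have := h (conjTest φ)
    rw [integral_mul_test] at this
    have e := integral_mul_test (derivTest (conjTest φ)) u
    simp only [derivTest_apply] at e
    rw [e] at this
    simpa [derivTest_conjTest] using this
  · intro h φ
    have := h (conjTest φ)
    rw [integral_mul_test]
    have e := integral_mul_test (derivTest φ) u
    simp only [derivTest_apply] at e
    rw [e, ← derivTest_conjTest, this]

theorem IsWeakDeriv.unique {u v v' : L2} (h : IsWeakDeriv u v) (h' : IsWeakDeriv u v') :
    v = v' := by
  rw [← sub_eq_zero]
  refine eq_zero_of_inner_test fun φ => ?_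
  have a := isWeakDeriv_iff.1 h φ
  have b := isWeakDeriv_iff.1 h' φ
  rw [inner_sub_right, sub_eq_zero]
  exact neg_injective (a.symm.trans b)

theorem IsWeakDeriv.neg {u v : L2} (h : IsWeakDeriv u v) : IsWeakDeriv (-u) (-v) := by
  simpa using h.smul (-1)

theorem IsWeakDeriv.sub {u v u' v' : L2} (h : IsWeakDeriv u v) (h' : IsWeakDeriv u' v') :
    IsWeakDeriv (u - u') (v - v') := by
  simpa [sub_eq_add_neg] using h.add h'.neg

/-- A classical derivative is a weak derivative. -/
theorem isWeakDeriv_toLp {f f' : ℝ → ℂ} (hf : MemLp f 2 volume) (hf' : MemLp f' 2 volume)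
    (h : ∀ x, HasDerivAt f (f' x) x) : IsWeakDeriv (hf.toLp f) (hf'.toLp f') := by
  intro φ
  have e1 : ∫ x, hf.toLp f x * deriv φ x = ∫ x, f x * deriv φ x :=
    integral_congr_ae (hf.coeFn_toLp.mono fun x hx => by simp only [hx])
  have e2 : ∫ x, hf'.toLp f' x * φ x = ∫ x, f' x * φ x :=
    integral_congr_ae (hf'.coeFn_toLp.mono fun x hx => by simp only [hx])
  rw [e1, e2]
  exact integral_mul_deriv_eq_deriv_mul_of_integrable (fun x _ => h x)
    (fun x _ => (differentiable_test φ x).hasDerivAt)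
    (hf.integrable_mul (memLp_test (derivTest φ))) (hf'.integrable_mul (memLp_test φ))
    (hf.integrable_mul (memLp_test φ))

theorem isWeakDeriv_testToL2 (f : TestFn) : IsWeakDeriv (testToL2 f) (testToL2 (derivTest f)) :=
  isWeakDeriv_toLp (memLp_test f) (memLp_test (derivTest f))
    fun x => (differentiable_test f x).hasDerivAt

theorem isClosed_isWeakDeriv : IsClosed {p : L2 × L2 | IsWeakDeriv p.1 p.2} := by
  simp only [isWeakDeriv_iff, Set.ofPred_forall]
  exact isClosed_iInter fun φ => isClosed_eq (by fun_prop) (by fun_prop)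

/-! ### First-order equations in the weak sense -/

/-- A test function with mean zero has a primitive among the test functions. -/
theorem exists_derivTest_eq {g : TestFn} (hg : ∫ x, g x = 0) : ∃ φ : TestFn, derivTest φ = g := by
  have hi : Integrable g := g.continuous.integrable_of_hasCompactSupport g.hasCompactSupport
  obtain ⟨R, hR⟩ := g.hasCompactSupport.isBounded.subset_closedBall 0
  have hz : ∀ x, R < |x| → g x = 0 := fun x hx => image_eq_zero_of_notMem_tsupport fun h' => by
    have := hR h'
    simp only [Metric.mem_closedBall, dist_zero_right, Real.norm_eq_abs] at this
    linarith
  let Φ : ℝ → ℂ := fun x => ∫ t in Set.Iic x, g t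
  have hd : ∀ x, HasDerivAt Φ (g x) x := fun x => by
    have e : Φ = fun x => (∫ t in Set.Iic (0 : ℝ), g t) + ∫ t in (0 : ℝ)..x, g t := by
      funext x
      rw [← intervalIntegral.integral_Iic_sub_Iic hi.integrableOn hi.integrableOn]
      simp [Φ]
    rw [e]
    exact (intervalIntegral.integral_hasDerivAt_right (hi.intervalIntegrable)
      (g.continuous.stronglyMeasurableAtFilter _ _) g.continuous.continuousAt).const_add _
  have hs : ∀ x, R < |x| → Φ x = 0 := by
    intro x hx
    rcases le_total x 0 with h0 | h0
    · refine setIntegral_eq_zero_of_forall_eq_zero fun t ht => hz t ?_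
      have : t ≤ x := ht
      rw [abs_of_nonpos h0] at hx
      exact lt_of_lt_of_le (by linarith) (neg_le_abs t)
    · have e : Φ x = ∫ t, g t := by
        refine setIntegral_eq_integral_of_forall_compl_eq_zero fun t ht => hz t ?_
        have : x < t := not_le.1 ht
        rw [abs_of_nonneg h0] at hx
        exact lt_of_lt_of_le (by linarith) (le_abs_self t)
      rw [e, hg]
  have hdd : deriv Φ = g := funext fun x => (hd x).deriv
  refine ⟨mkTest Φ (contDiff_infty_iff_deriv.2 ⟨fun x => (hd x).differentiableAt, ?_⟩) ?_, ?_⟩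
  · rw [hdd]; exact g.contDiff
  · refine HasCompactSupport.of_support_subset_isCompact (isCompact_closedBall (0 : ℝ) R) ?_
    intro x hx
    by_contra h
    refine hx (hs x ?_)
    simpa using h
  · ext x; exact (hd x).deriv

/-- The exponential `t ↦ e^{ct}` with real `c` is not integrable on the line. -/
theorem not_integrable_exp_mul (c : ℝ) : ¬ Integrable fun x : ℝ => Real.exp (c * x) := by
  intro h
  have h1 := h.measure_norm_ge_lt_top one_pos
  rcases le_total 0 c with hc | hc
  · have : Set.Ici (0 : ℝ) ⊆ {x | 1 ≤ ‖Real.exp (c * x)‖} := fun x hx => by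
      simpa using mul_nonneg hc hx
    simpa using (measure_mono this).trans_lt h1
  · have : Set.Iic (0 : ℝ) ⊆ {x | 1 ≤ ‖Real.exp (c * x)‖} := fun x hx => by
      simpa using mul_nonneg_of_nonpos_of_nonpos hc hx
    simpa using (measure_mono this).trans_lt h1

/-- The weak equation `z' = c z` has no square integrable solution except zero: its solutions are
the multiples of `e^{ct}`. -/
theorem eq_zero_of_isWeakDeriv_smul {z : L2} {c : ℝ} (h : IsWeakDeriv z ((c : ℂ) • z)) :
    z = 0 := by
  -- the equation, tested with `e^{-ct} Φ`
  have key : ∀ Φ : TestFn, ∫ x, (z x * Complex.exp (-(c * x))) * derivTest Φ x = 0 := by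
    intro Φ
    have hE : ContDiff ℝ (⊤ : ℕ∞) fun x : ℝ => Complex.exp (-(c * x)) := by
      have : ContDiff ℝ (⊤ : ℕ∞) fun x : ℝ => (x : ℂ) := Complex.ofRealCLM.contDiff
      fun_prop
    have hEd : ∀ x : ℝ, HasDerivAt (fun x : ℝ => Complex.exp (-(c * x)))
        (Complex.exp (-(c * x)) * -c) x := fun x => by
      have : HasDerivAt (fun x : ℝ => -((c : ℂ) * (x : ℂ))) (-c) x := by
        have := ((Complex.ofRealCLM.hasDerivAt (x := x)).const_mul (c : ℂ)).neg
        simpa [Pi.neg_def] using this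
      exact this.cexp
    let φ : TestFn := mkTest (fun x => Complex.exp (-(c * x)) * Φ x) (hE.mul Φ.contDiff)
      Φ.hasCompactSupport.mul_left
    have hφ : ∀ x, deriv φ x = Complex.exp (-(c * x)) * derivTest Φ x - c * φ x := fun x => by
      have := (hEd x).mul (differentiable_test Φ x).hasDerivAt
      refine this.deriv.trans ?_
      change _ = _ * deriv Φ x - c * (Complex.exp (-(c * x)) * Φ x)
      ring
    have h1 := h φ
    have e : ∫ x, ((c : ℂ) • z) x * φ x = ∫ x, c * (z x * φ x) :=
      integral_congr_ae ((Lp.coeFn_smul (c : ℂ) z).mono fun x hx => by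
        simp only [hx, Pi.smul_apply, smul_eq_mul, mul_assoc])
    have i1 := (integrable_L2_mul z _ φ.continuous φ.hasCompactSupport).const_mul (c : ℂ)
    have i2 := integrable_L2_mul z _ (continuous_deriv_test φ) φ.hasCompactSupport.deriv
    rw [e] at h1
    calc _ = ∫ x, z x * deriv φ x + c * (z x * φ x) := by
          congr 1; funext x; rw [hφ]; ring
      _ = 0 := by rw [integral_add i2 i1, h1]; ring
  have hloc : LocallyIntegrable fun x => z x * Complex.exp (-(c * x)) := by
    have := ((Lp.memLp z).locallyIntegrable (by norm_num)).smul_continuous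
      (g := fun x : ℝ => Complex.exp (-(c * x))) (by fun_prop)
    simpa [smul_eq_mul] using this
  obtain ⟨η, hη⟩ : ∃ η : TestFn, ∫ x, η x = 1 := by
    let b : ContDiffBump (0 : ℝ) := ⟨1, 2, one_pos, by norm_num⟩
    refine ⟨realTest _ (b.contDiff_normed (μ := volume)) b.hasCompactSupport_normed, ?_⟩
    simp only [realTest_apply]
    rw [integral_complex_ofReal, b.integral_normed]
    simp
  -- a test function `φ` minus `(∫ φ) η` has mean zero, hence is a derivative; so `e^{-ct} z` is
  -- the constant `κ`
  set κ : ℂ := ∫ x, (z x * Complex.exp (-(c * x))) * η x with hκ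
  have int : ∀ φ : TestFn, Integrable fun x => (z x * Complex.exp (-(c * x))) * φ x := fun φ => by
    have := integrable_L2_mul z (fun x => Complex.exp (-(c * x)) * φ x) (by fun_prop)
      φ.hasCompactSupport.mul_left
    simpa [mul_assoc] using this
  have int' : ∀ φ : TestFn, Integrable φ := fun φ =>
    φ.continuous.integrable_of_hasCompactSupport φ.hasCompactSupport
  have hconst : ∀ᵐ x, z x * Complex.exp (-(c * x)) - κ = 0 := by
    refine ae_eq_zero_of_integral_mul_test (hloc.sub (locallyIntegrable_const κ)) fun φ => ?_
    set s : ℂ := ∫ x, φ x with hs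
    have h0 : ∫ x, (φ - s • η : TestFn) x = 0 := by
      change ∫ x, φ x - s * η x = 0
      rw [integral_sub (int' φ) ((int' η).const_mul s), integral_const_mul, hη]
      simp [hs]
    obtain ⟨Φ, hΦ⟩ := exists_derivTest_eq h0
    have h1 := key Φ
    rw [hΦ] at h1
    have h2 : ∫ x, (z x * Complex.exp (-(c * x))) * φ x
        - s * ((z x * Complex.exp (-(c * x))) * η x) = 0 := by
      rw [← h1]
      congr 1; funext x
      change _ = z x * Complex.exp (-(c * x)) * (φ x - s * η x)
      ring
    rw [integral_sub (int φ) ((int η).const_mul s), integral_const_mul, ← hκ] at h2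
    simp only [sub_mul]
    rw [integral_sub (int φ) ((int' φ).const_mul κ), integral_const_mul, ← hs, mul_comm κ]
    exact h2
  have hz : ∀ᵐ x, z x = κ * Complex.exp (c * x) := hconst.mono fun x hx => by
    rw [sub_eq_zero] at hx
    rw [← hx, mul_assoc, ← Complex.exp_add]
    simp
  have hκ0 : κ = 0 := by
    by_contra hne
    refine not_integrable_exp_mul (2 * c) ?_
    have hi : Integrable fun x => ‖z x‖ ^ 2 := (Lp.memLp z).norm.integrable_sq
    refine (hi.const_mul (‖κ‖ ^ 2)⁻¹).congr (hz.mono fun x hx => ?_)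
    have : ‖κ‖ ≠ 0 := norm_ne_zero_iff.2 hne
    have e : ‖Complex.exp (c * x)‖ = Real.exp (c * x) := by
      rw [Complex.norm_exp]; simp
    simp only [hx, norm_mul, e, mul_pow]
    rw [← Real.exp_nat_mul]
    field_simp
    congr 1
    push_cast
    ring
  exact (Lp.eq_zero_iff_ae_eq_zero).2 (hz.mono fun x hx => by simp [hx, hκ0])

/-! ### Decay of the potential and multiplication by `m² + V` -/

theorem abs_vWN_le (x : ℝ) : |vWN x| ≤ 32 * (|zeta x| + 3) / (1 + zeta x ^ 2) := by
  set t := |zeta x| with ht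
  have ht2 : zeta x ^ 2 = t ^ 2 := (sq_abs _).symm
  have hs : |Real.sin x| ≤ 1 := Real.abs_sin_le_one x
  have hc : |Real.cos x| ≤ 1 := Real.abs_cos_le_one x
  have hs3 : |Real.sin x ^ 3| ≤ 1 := by rw [abs_pow]; exact pow_le_one₀ (abs_nonneg _) hs
  have h0 : 0 ≤ t := abs_nonneg _
  have hN : |zeta x ^ 3 * Real.cos x - 3 * zeta x ^ 2 * Real.sin x ^ 3 + zeta x * Real.cos x
        + Real.sin x ^ 3| ≤ (t + 3) * (1 + t ^ 2) := by
    have a1 : |zeta x ^ 3 * Real.cos x| ≤ t ^ 3 := by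
      rw [abs_mul, abs_pow]; exact mul_le_of_le_one_right (by positivity) hc
    have a2 : |3 * zeta x ^ 2 * Real.sin x ^ 3| ≤ 3 * t ^ 2 := by
      rw [abs_mul, ht2, abs_of_nonneg (by positivity : 0 ≤ 3 * t ^ 2)]
      exact mul_le_of_le_one_right (by positivity) hs3
    have a3 : |zeta x * Real.cos x| ≤ t := by
      rw [abs_mul]; exact mul_le_of_le_one_right h0 hc
    rw [abs_le] at *
    constructor <;> nlinarith
  rw [ht2] at hN
  unfold vWN
  rw [abs_div, abs_mul, abs_mul, ht2, abs_of_nonneg (by positivity : 0 ≤ (1 + t ^ 2) ^ 2),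
    div_le_div_iff₀ (by positivity) (by positivity)]
  have : |(-32 : ℝ)| * |Real.sin x| ≤ 32 := by
    rw [abs_neg, abs_of_pos (by norm_num : (0 : ℝ) < 32)]; linarith
  calc _ ≤ 32 * ((t + 3) * (1 + t ^ 2)) * (1 + t ^ 2) := by gcongr
    _ = _ := by ring

theorem abs_vWN_le_const (x : ℝ) : |vWN x| ≤ 128 := by
  refine (abs_vWN_le x).trans ?_
  rw [div_le_iff₀ (by positivity), ← sq_abs (zeta x)]
  nlinarith [sq_nonneg (|zeta x| - 1), sq_nonneg (|zeta x|)]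

theorem abs_vWN_mul_abs_zeta_le (x : ℝ) : |vWN x| * |zeta x| ≤ 128 := by
  have h := mul_le_mul_of_nonneg_right (abs_vWN_le x) (abs_nonneg (zeta x))
  refine h.trans ?_
  rw [div_mul_eq_mul_div, div_le_iff₀ (by positivity), ← sq_abs (zeta x)]
  nlinarith [sq_nonneg (|zeta x| - 1), sq_nonneg (|zeta x|)]

theorem norm_weight_le (m x : ℝ) : ‖((m ^ 2 + vWN x : ℝ) : ℂ)‖ ≤ m ^ 2 + 128 := by
  rw [Complex.norm_real, Real.norm_eq_abs]
  refine (abs_add_le _ _).trans ?_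
  rw [abs_of_nonneg (sq_nonneg m)]
  linarith [abs_vWN_le_const x]

theorem memLp_weight_mul (m : ℝ) {u : ℝ → ℂ} (hu : MemLp u 2 volume) :
    MemLp (fun x => ((m ^ 2 + vWN x : ℝ) : ℂ) * u x) 2 volume :=
  hu.of_le_mul (c := m ^ 2 + 128)
    ((continuous_weight m).aestronglyMeasurable.mul hu.aestronglyMeasurable)
    (Filter.Eventually.of_forall fun x => by
      rw [norm_mul]
      exact mul_le_mul_of_nonneg_right (norm_weight_le m x) (norm_nonneg _))

/-- Multiplication by `m² + V` on `L²(ℝ)`. -/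
def weightMul (m : ℝ) : L2 →L[ℂ] L2 :=
  LinearMap.mkContinuous
    { toFun := fun u => (memLp_weight_mul m (Lp.memLp u)).toLp _
      map_add' := fun u v => by
        rw [← MemLp.toLp_add]
        refine MemLp.toLp_congr _ _ ((Lp.coeFn_add u v).mono fun x hx => ?_)
        simp only [hx, Pi.add_apply, mul_add]
      map_smul' := fun c u => by
        rw [RingHom.id_apply, ← MemLp.toLp_const_smul]
        refine MemLp.toLp_congr _ _ ((Lp.coeFn_smul c u).mono fun x hx => ?_)
        simp only [hx, Pi.smul_apply, smul_eq_mul, mul_left_comm] }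
    (m ^ 2 + 128) fun u => by
      refine Lp.norm_le_mul_norm_of_ae_le_mul ?_
      filter_upwards [(memLp_weight_mul m (Lp.memLp u)).coeFn_toLp] with x hx
      simp only [LinearMap.coe_mk, AddHom.coe_mk]
      rw [hx, norm_mul]
      exact mul_le_mul_of_nonneg_right (norm_weight_le m x) (norm_nonneg _)

theorem coeFn_weightMul (m : ℝ) (u : L2) :
    weightMul m u =ᵐ[volume] fun x => ((m ^ 2 + vWN x : ℝ) : ℂ) * u x :=
  (memLp_weight_mul m (Lp.memLp u)).coeFn_toLp

theorem norm_weightMul_le (m : ℝ) (u : L2) : ‖weightMul m u‖ ≤ (m ^ 2 + 128) * ‖u‖ :=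
  (LinearMap.mkContinuous_norm_le _ (by positivity) _ |> (weightMul m).le_of_opNorm_le) u

theorem inner_weightMul (m : ℝ) (u v : L2) :
    inner ℂ u (weightMul m v) = ∫ x, ((m ^ 2 + vWN x : ℝ) : ℂ) * (conj (u x) * v x) := by
  rw [inner_L2]
  refine integral_congr_ae ((coeFn_weightMul m v).mono fun x hx => ?_)
  simp only [hx, mul_left_comm]

theorem inner_weightMul_comm (m : ℝ) (u v : L2) :
    inner ℂ (weightMul m u) v = inner ℂ u (weightMul m v) := by
  rw [inner_weightMul, inner_L2]
  refine integral_congr_ae ((coeFn_weightMul m u).mono fun x hx => ?_)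
  simp only [hx, map_mul, Complex.conj_ofReal, mul_assoc]

/-! ### The Sobolev space as a graph, and density of the test functions -/

/-- The graph of the weak derivative, a closed subspace of `L² × L²`. It is the space `H¹(ℝ)` with
a norm that is equivalent to the usual one. -/
def weakGraph : Submodule ℂ (L2 × L2) where
  carrier := {p | IsWeakDeriv p.1 p.2}
  zero_mem' := .zero
  add_mem' := .add
  smul_mem' c _ h := .smul c h

instance : CompleteSpace weakGraph := isClosed_isWeakDeriv.completeSpace_coe

/-- A test function together with its derivative. -/
def testToWeakGraph : TestFn →ₗ[ℂ] weakGraph :=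
  (testToL2.prod (testToL2.comp derivTest)).codRestrict weakGraph isWeakDeriv_testToL2

/-- The test functions are dense in `H¹(ℝ)`. If `(u, u')` is orthogonal to all of them, then
`u'' = u`, so that `u ± u'` solve first-order equations without square integrable solutions. -/
theorem denseRange_testToWeakGraph : DenseRange testToWeakGraph := by
  let T : TestFn →ₗ[ℂ] WithLp 2 (L2 × L2) :=
    (WithLp.linearEquiv 2 ℂ (L2 × L2)).symm.toLinearMap ∘ₗ testToL2.prod (testToL2.comp derivTest)
  have key : ∀ p ∈ weakGraph, WithLp.toLp 2 p ∈ T.range.topologicalClosure := by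
    intro p hp
    set S := T.range.topologicalClosure with hS
    have : CompleteSpace S := T.range.isClosed_topologicalClosure.completeSpace_coe
    have hSG : ∀ q ∈ S, WithLp.ofLp q ∈ weakGraph := by
      have hcl : IsClosed {q : WithLp 2 (L2 × L2) | WithLp.ofLp q ∈ weakGraph} :=
        isClosed_isWeakDeriv.preimage (WithLp.prod_continuous_ofLp 2 L2 L2)
      intro q hq
      refine closure_minimal ?_ hcl hq
      rintro _ ⟨φ, rfl⟩
      exact isWeakDeriv_testToL2 φ
    set r := WithLp.toLp 2 p - S.starProjection (WithLp.toLp 2 p) with hr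
    have hrG : WithLp.ofLp r ∈ weakGraph :=
      weakGraph.sub_mem hp (hSG _ (Submodule.starProjection_apply_mem _ _))
    have hro : r ∈ Sᗮ := Submodule.sub_starProjection_mem_orthogonal _
    obtain ⟨u, hu⟩ : ∃ u, u = (WithLp.ofLp r).1 := ⟨_, rfl⟩
    obtain ⟨v, hv⟩ : ∃ v, v = (WithLp.ofLp r).2 := ⟨_, rfl⟩
    have huv : IsWeakDeriv u v := by rw [hu, hv]; exact hrG
    have hvu : IsWeakDeriv v u := by
      refine isWeakDeriv_iff.2 fun φ => ?_
      have := hro (T φ) (T.range.le_topologicalClosure ⟨φ, rfl⟩)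
      rw [WithLp.prod_inner_apply, ← hu, ← hv] at this
      have h2 : inner ℂ (testToL2 φ) u + inner ℂ (testToL2 (derivTest φ)) v = 0 := this
      exact eq_neg_of_add_eq_zero_right h2
    have h1 : u + v = 0 := eq_zero_of_isWeakDeriv_smul (c := 1) (by
      simpa [add_comm v u] using huv.add hvu)
    have h2 : u - v = 0 := eq_zero_of_isWeakDeriv_smul (c := -1) (by
      simpa using huv.sub hvu)
    have hv0 : v = 0 := by
      have : (2 : ℂ) • v = (u + v) - (u - v) := by module
      rw [h1, h2, sub_zero] at this
      simpa using this
    have hu0 : u = 0 := by simpa [hv0] using h1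
    have hr0 : r = 0 := by
      apply (WithLp.equiv 2 (L2 × L2)).injective
      exact Prod.ext (hu.symm.trans hu0) (hv.symm.trans hv0)
    rw [sub_eq_zero.1 (hr.symm.trans hr0)]
    exact Submodule.starProjection_apply_mem _ _
  rintro ⟨p, hp⟩
  rw [Topology.IsInducing.subtypeVal.closure_eq_preimage_closure_image]
  have h1 := key p hp
  have h2 := map_mem_closure (WithLp.prod_continuous_ofLp 2 L2 L2) h1
    (t := Subtype.val '' Set.range testToWeakGraph) (by
      rintro _ ⟨φ, rfl⟩
      exact ⟨testToWeakGraph φ, ⟨φ, rfl⟩, rfl⟩)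
  exact h2

/-- Integration by parts in `H¹(ℝ)`. -/
theorem IsWeakDeriv.inner_eq {u u' v v' : L2} (hu : IsWeakDeriv u u') (hv : IsWeakDeriv v v') :
    inner ℂ u' v = -inner ℂ u v' := by
  have := denseRange_testToWeakGraph.induction_on
    (p := fun q : weakGraph => inner ℂ (q : L2 × L2).2 v = -inner ℂ (q : L2 × L2).1 v')
    ⟨(u, u'), hu⟩ (isClosed_eq (by fun_prop) (by fun_prop)) fun φ => isWeakDeriv_iff.1 hv φ
  exact this

/-! ### Identification of the energy space with `H¹ ⊕ L²` -/

/-- The energy form on `H¹ ⊕ L²`, where elements of `H¹` carry their weak derivative. -/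
def energyInner (m : ℝ) (a b : weakGraph × L2) : ℂ :=
  inner ℂ (a.1 : L2 × L2).2 (b.1 : L2 × L2).2
    + inner ℂ (a.1 : L2 × L2).1 (weightMul m (b.1 : L2 × L2).1) + inner ℂ a.2 b.2

/-- The inclusion of `C₀^∞(ℝ)²` in `H¹ ⊕ L²`. -/
def testToPair : TestFn × TestFn →ₗ[ℂ] weakGraph × L2 := testToWeakGraph.prodMap testToL2

theorem denseRange_testToPair : DenseRange testToPair :=
  denseRange_testToWeakGraph.prodMap denseRange_testToL2

theorem energyInner_testToPair (m : ℝ) (f g : TestFn × TestFn) :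
    energyInner m (testToPair f) (testToPair g) = energyForm m vWN f g := by
  have h1 := inner_testToL2 (derivTest f.1) (derivTest g.1)
  have h2 := inner_weightMul m (testToL2 f.1) (testToL2 g.1)
  have h3 := inner_testToL2 f.2 g.2
  have h4 : ∫ x, ((m ^ 2 + vWN x : ℝ) : ℂ) * (conj (testToL2 f.1 x) * testToL2 g.1 x) =
      ∫ x, ((m ^ 2 + vWN x : ℝ) : ℂ) * (conj (f.1 x) * g.1 x) := by
    refine integral_congr_ae ?_
    filter_upwards [coeFn_testToL2 f.1, coeFn_testToL2 g.1] with x hf hg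
    simp only [hf, hg]
  rw [h4] at h2
  exact congrArg₂ (· + ·) (congrArg₂ (· + ·) h1 h2) h3

theorem energyInner_self_re (m : ℝ) (a : weakGraph × L2) :
    (energyInner m a a).re = ‖(a.1 : L2 × L2).2‖ ^ 2
      + (inner ℂ (a.1 : L2 × L2).1 (weightMul m (a.1 : L2 × L2).1)).re + ‖a.2‖ ^ 2 := by
  unfold energyInner
  rw [Complex.add_re, Complex.add_re]
  congr 2
  · exact inner_self_eq_norm_sq (𝕜 := ℂ) _
  · exact inner_self_eq_norm_sq (𝕜 := ℂ) _

theorem abs_re_inner_weightMul_le (m : ℝ) (u : L2) :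
    |(inner ℂ u (weightMul m u)).re| ≤ (m ^ 2 + 128) * ‖u‖ ^ 2 := by
  refine (Complex.abs_re_le_norm _).trans ((norm_inner_le_norm _ _).trans ?_)
  have := mul_le_mul_of_nonneg_left (norm_weightMul_le m u) (norm_nonneg u)
  linarith

theorem norm_prod_sq_le (a : weakGraph × L2) :
    ‖a‖ ^ 2 ≤ ‖(a.1 : L2 × L2).1‖ ^ 2 + ‖(a.1 : L2 × L2).2‖ ^ 2 + ‖a.2‖ ^ 2 := by
  have e : ‖a‖ = max (max ‖(a.1 : L2 × L2).1‖ ‖(a.1 : L2 × L2).2‖) ‖a.2‖ := rfl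
  rw [e]
  rcases max_choice (max ‖(a.1 : L2 × L2).1‖ ‖(a.1 : L2 × L2).2‖) ‖a.2‖ with h | h <;> rw [h]
  · rcases max_choice ‖(a.1 : L2 × L2).1‖ ‖(a.1 : L2 × L2).2‖ with h | h <;> rw [h] <;>
      nlinarith [sq_nonneg ‖(a.1 : L2 × L2).1‖, sq_nonneg ‖(a.1 : L2 × L2).2‖, sq_nonneg ‖a.2‖]
  · nlinarith [sq_nonneg ‖(a.1 : L2 × L2).1‖, sq_nonneg ‖(a.1 : L2 × L2).2‖]

section

variable {m : ℝ} (hpos : EnergyPositive m vWN)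

/-- The canonical map of `C₀^∞(ℝ)²` into the energy space, as a linear map. -/
def toEnergyLinear : TestFn × TestFn →ₗ[ℂ] EnergySpace m hpos :=
  (UniformSpace.Completion.toComplL : TestPairs m hpos →L[ℂ] EnergySpace m hpos).toLinearMap ∘ₗ
    (TestPairs.equiv m hpos).toLinearMap

theorem toEnergyLinear_apply (f : TestFn × TestFn) :
    toEnergyLinear hpos f = toEnergy m hpos f := rfl

theorem denseRange_toEnergyLinear : DenseRange (toEnergyLinear hpos) :=
  (UniformSpace.Completion.denseRange_coe (α := TestPairs m hpos)).comp
    (TestPairs.equiv m hpos).surjective.denseRange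
    (UniformSpace.Completion.continuous_coe _)

theorem inner_toEnergyLinear (f g : TestFn × TestFn) :
    inner ℂ (toEnergyLinear hpos f) (toEnergyLinear hpos g) =
      energyInner m (testToPair f) (testToPair g) := by
  rw [energyInner_testToPair]
  exact UniformSpace.Completion.inner_coe (𝕜 := ℂ) (TestPairs.equiv m hpos f)
    (TestPairs.equiv m hpos g)

theorem norm_sq_toEnergyLinear (f : TestFn × TestFn) :
    ‖toEnergyLinear hpos f‖ ^ 2 = (energyInner m (testToPair f) (testToPair f)).re := by
  rw [← inner_toEnergyLinear]
  exact (inner_self_eq_norm_sq (𝕜 := ℂ) _).symm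

/-- As `V` is bounded, the energy norm is bounded by the `H¹ ⊕ L²` norm. -/
theorem exists_norm_toEnergyLinear_le :
    ∃ C : ℝ, ∀ f, ‖toEnergyLinear hpos f‖ ≤ C * ‖testToPair f‖ := by
  refine ⟨Real.sqrt (m ^ 2 + 130), fun f => ?_⟩
  refine le_of_sq_le_sq ?_ (by positivity)
  rw [norm_sq_toEnergyLinear, energyInner_self_re, mul_pow, Real.sq_sqrt (by positivity)]
  set a := testToPair f
  have h1 : ‖(a.1 : L2 × L2).1‖ ^ 2 ≤ ‖a‖ ^ 2 := by
    gcongr; exact (norm_fst_le (a.1 : L2 × L2)).trans (norm_fst_le a)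
  have h2 : ‖(a.1 : L2 × L2).2‖ ^ 2 ≤ ‖a‖ ^ 2 := by
    gcongr; exact (norm_snd_le (a.1 : L2 × L2)).trans (norm_fst_le a)
  have h3 : ‖a.2‖ ^ 2 ≤ ‖a‖ ^ 2 := by gcongr; exact norm_snd_le a
  have h4 := (le_abs_self _).trans (abs_re_inner_weightMul_le m (a.1 : L2 × L2).1)
  nlinarith [sq_nonneg m]

/-- Strict positivity of the energy form and boundedness of `V` control the `H¹` norm by the
energy norm. -/
theorem exists_norm_testToPair_le :
    ∃ C : ℝ, ∀ f, ‖testToPair f‖ ≤ C * ‖toEnergyLinear hpos f‖ := by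
  obtain ⟨ε, hε, h⟩ := id hpos
  refine ⟨Real.sqrt (ε⁻¹ + (1 + (m ^ 2 + 128) * ε⁻¹) + 1), fun f => ?_⟩
  refine le_of_sq_le_sq ?_ (by positivity)
  rw [mul_pow, Real.sq_sqrt (by positivity), norm_sq_toEnergyLinear, energyInner_self_re]
  have hf : ε * ‖((testToPair f).1 : L2 × L2).1‖ ^ 2 ≤ ‖((testToPair f).1 : L2 × L2).2‖ ^ 2
      + (inner ℂ ((testToPair f).1 : L2 × L2).1
        (weightMul m ((testToPair f).1 : L2 × L2).1)).re := by
    have e := energyInner_testToPair m (f.1, 0)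
    have e' := congrArg Complex.re (e (f.1, 0))
    rw [energyForm_self, energyInner_self_re, Complex.ofReal_re] at e'
    have z : ‖(testToPair (f.1, 0)).2‖ ^ 2 = 0 := by simp [testToPair]
    have z' : ∫ x, ‖(0 : TestFn) x‖ ^ 2 = 0 := by simp
    rw [z] at e'
    simp only [z', add_zero] at e'
    have n : ‖((testToPair f).1 : L2 × L2).1‖ ^ 2 = ∫ x, ‖f.1 x‖ ^ 2 := norm_sq_testToL2 f.1
    rw [n]
    exact (h f.1).trans_eq e'.symm
  set a := testToPair f
  set A := ‖(a.1 : L2 × L2).2‖ ^ 2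
      + (inner ℂ (a.1 : L2 × L2).1 (weightMul m (a.1 : L2 × L2).1)).re with hA
  have h4 := (neg_abs_le _).trans' (neg_le_neg (abs_re_inner_weightMul_le m (a.1 : L2 × L2).1))
  have h5 : ‖(a.1 : L2 × L2).1‖ ^ 2 ≤ ε⁻¹ * A := by
    rw [inv_mul_eq_div, le_div_iff₀ hε]; linarith
  have h6 : (m ^ 2 + 128) * ‖(a.1 : L2 × L2).1‖ ^ 2 ≤ (m ^ 2 + 128) * (ε⁻¹ * A) := by gcongr
  have hA0 : 0 ≤ A := le_trans (by positivity) hf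
  have h7 : 0 ≤ (ε⁻¹ + (1 + (m ^ 2 + 128) * ε⁻¹)) * ‖a.2‖ ^ 2 := by positivity
  have := norm_prod_sq_le a
  nlinarith

/-- The energy space is isomorphic to `H¹ ⊕ L²`. -/
def energyEquiv : (weakGraph × L2) ≃L[ℂ] EnergySpace m hpos :=
  (LinearEquiv.refl ℂ (TestFn × TestFn)).extend testToPair (toEnergyLinear hpos)
    denseRange_testToPair (exists_norm_toEnergyLinear_le hpos)
    (denseRange_toEnergyLinear hpos) (exists_norm_testToPair_le hpos)

theorem energyEquiv_testToPair (f : TestFn × TestFn) :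
    energyEquiv hpos (testToPair f) = toEnergy m hpos f :=
  LinearEquiv.extend_eq _ _ _ _ _ _ _ f

theorem inner_energyEquiv (a b : weakGraph × L2) :
    inner ℂ (energyEquiv hpos a) (energyEquiv hpos b) = energyInner m a b := by
  have hc : Continuous fun p : (weakGraph × L2) × (weakGraph × L2) =>
      energyInner m p.1 p.2 := by
    unfold energyInner; fun_prop
  refine (denseRange_testToPair.prodMap denseRange_testToPair).induction_on
    (p := fun p => inner ℂ (energyEquiv hpos p.1) (energyEquiv hpos p.2) = energyInner m p.1 p.2)
    (a, b) (isClosed_eq (by fun_prop) hc) ?_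
  rintro ⟨f, g⟩
  change inner ℂ (energyEquiv hpos (testToPair f)) (energyEquiv hpos (testToPair g)) = _
  rw [energyEquiv_testToPair, energyEquiv_testToPair]
  exact inner_toEnergyLinear hpos f g

/-- An element of `H¹(ℝ)` is determined by, and determines, the pair of itself and its weak
derivative. -/
def weakGraphEquiv : weakGraph ≃ₗ[ℂ] sobolevH1 :=
  LinearEquiv.ofBijective
    (((LinearMap.fst ℂ L2 L2).comp weakGraph.subtype).codRestrict sobolevH1
      fun p => ⟨(p : L2 × L2).2, p.2⟩)
    ⟨by
      rintro ⟨⟨u, v⟩, h⟩ ⟨⟨u', v'⟩, h'⟩ e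
      obtain rfl : u = u' := congrArg Subtype.val e
      obtain rfl : v = v' := IsWeakDeriv.unique h h'
      rfl,
     by
      rintro ⟨u, v, h⟩
      exact ⟨⟨(u, v), h⟩, rfl⟩⟩

theorem weakGraphEquiv_symm_eq {u : sobolevH1} {u' : L2} (h : IsWeakDeriv u u') :
    weakGraphEquiv.symm u = ⟨((u : L2), u'), h⟩ := by
  rw [LinearEquiv.symm_apply_eq]
  rfl

/-- The identification of `H¹(ℝ) ⊕ L²(ℝ)` with the energy space. -/
def energyIdent : (sobolevH1 × L2) ≃ₗ[ℂ] EnergySpace m hpos :=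
  (weakGraphEquiv.symm.prodCongr (LinearEquiv.refl ℂ L2)).trans (energyEquiv hpos).toLinearEquiv

/-- The identification in terms of an explicit weak derivative. -/
theorem energyIdent_apply {u : sobolevH1} {u' : L2} (h : IsWeakDeriv u u') (w : L2) :
    energyIdent hpos (u, w) = energyEquiv hpos (⟨((u : L2), u'), h⟩, w) := by
  rw [← weakGraphEquiv_symm_eq h]
  rfl

theorem inner_energyIdent (u v : sobolevH1 × L2) {u' v' : L2} (hu : IsWeakDeriv u.1 u')
    (hv : IsWeakDeriv v.1 v') :
    inner ℂ (energyIdent hpos u) (energyIdent hpos v) =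
      inner ℂ u' v' + inner ℂ (u.1 : L2) (weightMul m (v.1 : L2)) + inner ℂ u.2 v.2 := by
  rw [energyIdent_apply hpos hu, energyIdent_apply hpos hv, inner_energyEquiv]
  rfl

/-- A test function as an element of `H¹(ℝ)`. -/
def testToH1 (f : TestFn) : sobolevH1 := ⟨testToL2 f, _, isWeakDeriv_testToL2 f⟩

theorem energyIdent_test (f : TestFn × TestFn) :
    energyIdent hpos (testToH1 f.1, testToL2 f.2) = toEnergy m hpos f := by
  rw [← energyEquiv_testToPair]
  exact energyIdent_apply hpos (u := testToH1 f.1) (isWeakDeriv_testToL2 f.1) (testToL2 f.2)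

theorem isEnergyIdentification_energyIdent :
    IsEnergyIdentification m hpos (energyIdent hpos) := by
  refine ⟨fun f => ⟨(testToH1 f.1, testToL2 f.2), coeFn_testToL2 f.1, coeFn_testToL2 f.2,
    energyIdent_test hpos f⟩, fun u v u' v' hu hv => ?_⟩
  rw [inner_energyIdent hpos u v hu hv, inner_L2, inner_weightMul, inner_L2]

end

/-! ### Symmetric surjective operators are self-adjoint -/

/-- A densely defined symmetric operator onto the whole space is self-adjoint: if `A† y = A x`, then
`y - x` is orthogonal to the range of `A`. -/
theorem isSelfAdjoint_of_symmetric_of_surjective {K : Type*} [NormedAddCommGroup K]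
    [InnerProductSpace ℂ K] [CompleteSpace K] {A : K →ₗ.[ℂ] K} (hd : Dense (A.domain : Set K))
    (hs : A.IsFormalAdjoint A) (hsurj : ∀ z, ∃ x : A.domain, A x = z) : IsSelfAdjoint A := by
  rw [LinearPMap.isSelfAdjoint_def]
  have hle : A ≤ A.adjoint := hs.le_adjoint hd
  refine (LinearPMap.eq_of_le_of_domain_eq hle (le_antisymm hle.1 fun y hy => ?_)).symm
  obtain ⟨x, hx⟩ := hsurj (A.adjoint ⟨y, hy⟩)
  have hyx : y - x = 0 := by
    refine ext_inner_right ℂ fun w => ?_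
    obtain ⟨z, rfl⟩ := hsurj w
    have h1 := LinearPMap.adjoint_isFormalAdjoint hd ⟨y, hy⟩ z
    have h2 := hs x z
    rw [hx] at h2
    rw [inner_zero_left, inner_sub_left, sub_eq_zero]
    exact h1.symm.trans h2
  rw [sub_eq_zero.1 hyx]
  exact x.2

/-! ### The Klein-Gordon operator in the energy space -/

/-- The action of the matrix as an equation in `L²(ℝ)`. -/
theorem kgAction_iff {m : ℝ} {u v : sobolevH1 × L2} : KGAction m u v ↔
    (v.1 : L2) = u.2 ∧ ∃ d w : L2, IsWeakDeriv u.1 d ∧ IsWeakDeriv d w ∧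
      v.2 = -w + weightMul m (u.1 : L2) := by
  refine and_congr_right fun _ => exists_congr fun d => exists_congr fun w =>
    and_congr_right fun _ => and_congr_right fun _ => ?_
  have e : (-w + weightMul m (u.1 : L2) : L2) =ᵐ[volume]
      fun x => -w x + ((m ^ 2 + vWN x : ℝ) : ℂ) * (u.1 : L2) x := by
    filter_upwards [Lp.coeFn_add (-w) (weightMul m (u.1 : L2)), Lp.coeFn_neg w,
      coeFn_weightMul m (u.1 : L2)] with x h1 h2 h3
    rw [h1, Pi.add_apply, h2, h3, Pi.neg_apply]
  exact ⟨fun h => Lp.ext (h.trans e.symm), fun h => h ▸ e⟩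

theorem KGAction.add {m : ℝ} {u v u' v' : sobolevH1 × L2} (h : KGAction m u v)
    (h' : KGAction m u' v') : KGAction m (u + u') (v + v') := by
  rw [kgAction_iff] at *
  obtain ⟨h1, d, w, hd, hw, h2⟩ := h
  obtain ⟨h1', d', w', hd', hw', h2'⟩ := h'
  refine ⟨congrArg₂ (· + ·) h1 h1', d + d', w + w', hd.add hd', hw.add hw', ?_⟩
  have e : ((u + u').1 : L2) = (u.1 : L2) + u'.1 := rfl
  rw [Prod.snd_add, h2, h2', e, map_add]
  abel

theorem KGAction.smul {m : ℝ} {u v : sobolevH1 × L2} (c : ℂ) (h : KGAction m u v) :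
    KGAction m (c • u) (c • v) := by
  rw [kgAction_iff] at *
  obtain ⟨h1, d, w, hd, hw, h2⟩ := h
  refine ⟨congrArg (c • ·) h1, c • d, c • w, hd.smul c, hw.smul c, ?_⟩
  have e : ((c • u).1 : L2) = c • (u.1 : L2) := rfl
  rw [Prod.smul_snd, h2, e, map_smul, smul_add, smul_neg]

theorem KGAction.zero (m : ℝ) : KGAction m 0 0 :=
  kgAction_iff.2 ⟨rfl, 0, 0, .zero, .zero, by simp⟩

theorem KGAction.eq_zero {m : ℝ} {v : sobolevH1 × L2} (h : KGAction m 0 v) : v = 0 := by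
  obtain ⟨h1, d, w, hd, hw, h2⟩ := kgAction_iff.1 h
  obtain rfl : d = 0 := hd.unique .zero
  obtain rfl : w = 0 := hw.unique .zero
  refine Prod.ext (Subtype.ext h1) ?_
  simpa using h2

/-- The matrix `[[0, 1], [l, 0]]` is defined on `H² ⊕ H¹`. -/
theorem exists_kgAction_iff {m : ℝ} {u : sobolevH1 × L2} :
    (∃ v, KGAction m u v) ↔ (u.1 : L2) ∈ sobolevH2 ∧ u.2 ∈ sobolevH1 := by
  simp only [kgAction_iff]
  constructor
  · rintro ⟨v, h1, d, w, hd, hw, -⟩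
    exact ⟨⟨d, w, hd, hw⟩, h1 ▸ v.1.2⟩
  · rintro ⟨⟨d, w, hd, hw⟩, h⟩
    exact ⟨(⟨u.2, h⟩, -w + weightMul m (u.1 : L2)), rfl, d, w, hd, hw, rfl⟩

theorem kgAction_test (m : ℝ) (f : TestFn × TestFn) :
    KGAction m (testToH1 f.1, testToL2 f.2)
      (testToH1 (hTest m f).1, testToL2 (hTest m f).2) := by
  refine ⟨rfl, testToL2 (derivTest f.1), testToL2 (derivTest (derivTest f.1)),
    isWeakDeriv_testToL2 _, isWeakDeriv_testToL2 _, ?_⟩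
  filter_upwards [coeFn_testToL2 (hTest m f).2, coeFn_testToL2 f.1,
    coeFn_testToL2 (derivTest (derivTest f.1))] with x h1 h2 h3
  have e : ((testToH1 f.1 : sobolevH1) : L2) x = f.1 x := h2
  simp only [h1, h3, e]
  rfl

section

variable {m : ℝ} (hpos : EnergyPositive m vWN)

/-- The graph of the Klein-Gordon operator in the energy space. -/
def kgGraph : Submodule ℂ (EnergySpace m hpos × EnergySpace m hpos) where
  carrier := {p | ∃ u v, KGAction m u v ∧ energyIdent hpos u = p.1 ∧ energyIdent hpos v = p.2}
  zero_mem' := ⟨0, 0, .zero m, map_zero _, map_zero _⟩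
  add_mem' := by
    rintro ⟨_, _⟩ ⟨_, _⟩ ⟨u, v, h, rfl, rfl⟩ ⟨u', v', h', rfl, rfl⟩
    exact ⟨_, _, h.add h', map_add _ _ _, map_add _ _ _⟩
  smul_mem' := by
    rintro c ⟨_, _⟩ ⟨u, v, h, rfl, rfl⟩
    exact ⟨_, _, h.smul c, map_smul _ _ _, map_smul _ _ _⟩

/-- The Klein-Gordon operator in the energy space. -/
def kgOp : EnergySpace m hpos →ₗ.[ℂ] EnergySpace m hpos := (kgGraph hpos).toLinearPMap

theorem mem_graph_kgOp {y z : EnergySpace m hpos} : (y, z) ∈ (kgOp hpos).graph ↔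
    ∃ u v, KGAction m u v ∧ energyIdent hpos u = y ∧ energyIdent hpos v = z := by
  rw [kgOp, Submodule.toLinearPMap_graph_eq]
  · rfl
  · rintro ⟨_, _⟩ ⟨u, v, h, hu, rfl⟩ h0
    obtain rfl : u = 0 := (energyIdent hpos).map_eq_zero_iff.1 (hu.trans h0)
    rw [h.eq_zero, map_zero]

theorem mem_domain_kgOp {y : EnergySpace m hpos} : y ∈ (kgOp hpos).domain ↔
    ∃ u : sobolevH1 × L2, (u.1 : L2) ∈ sobolevH2 ∧ u.2 ∈ sobolevH1 ∧ energyIdent hpos u = y := by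
  simp only [LinearPMap.mem_domain_iff, mem_graph_kgOp]
  constructor
  · rintro ⟨_, u, v, h, hu, -⟩
    obtain ⟨h1, h2⟩ := exists_kgAction_iff.1 ⟨v, h⟩
    exact ⟨u, h1, h2, hu⟩
  · rintro ⟨u, h1, h2, hu⟩
    obtain ⟨v, h⟩ := exists_kgAction_iff.2 ⟨h1, h2⟩
    exact ⟨_, u, v, h, hu, rfl⟩

theorem kgOp_extends (f : TestFn × TestFn) :
    (toEnergy m hpos f, toEnergy m hpos (hTest m f)) ∈ (kgOp hpos).graph :=
  (mem_graph_kgOp hpos).2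
    ⟨_, _, kgAction_test m f, energyIdent_test hpos f, energyIdent_test hpos (hTest m f)⟩

theorem dense_domain_kgOp : Dense ((kgOp hpos).domain : Set (EnergySpace m hpos)) :=
  (denseRange_toEnergyLinear hpos).mono (by
    rintro _ ⟨f, rfl⟩
    exact LinearPMap.mem_domain_of_mem_graph (kgOp_extends hpos f))

/-- Symmetry of the operator: both sides are the same four terms after integration by parts. -/
theorem kgOp_isFormalAdjoint : (kgOp hpos).IsFormalAdjoint (kgOp hpos) := by
  intro x y
  obtain ⟨u, v, h, hu, hv⟩ := (mem_graph_kgOp hpos).1 ((kgOp hpos).mem_graph x)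
  obtain ⟨u', v', h', hu', hv'⟩ := (mem_graph_kgOp hpos).1 ((kgOp hpos).mem_graph y)
  obtain ⟨h1, d, w, hd, hw, h2⟩ := kgAction_iff.1 h
  obtain ⟨h1', d', w', hd', hw', h2'⟩ := kgAction_iff.1 h'
  obtain ⟨e, he⟩ := v.1.2
  obtain ⟨e', he'⟩ := v'.1.2
  rw [← hv, ← hu', ← hu, ← hv', inner_energyIdent hpos v u' he hd',
    inner_energyIdent hpos u v' hd he', h2, h2', ← h1, ← h1', inner_add_left, inner_add_right,
    inner_neg_left, inner_neg_right, he.inner_eq hw', inner_weightMul_comm,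
    ← neg_eq_iff_eq_neg.2 (hw.inner_eq he')]
  ring

/-- `0` belongs to the resolvent set: the Riesz representation theorem in the energy space solves
`l u = g` weakly. -/
theorem kgOp_surjective (z : EnergySpace m hpos) : ∃ x : (kgOp hpos).domain, kgOp hpos x = z := by
  obtain ⟨g, rfl⟩ := (energyIdent hpos).surjective z
  let F : EnergySpace m hpos →L[ℂ] ℂ :=
    (innerSL ℂ g.2).comp (((ContinuousLinearMap.fst ℂ L2 L2).comp weakGraph.subtypeL).comp
      ((ContinuousLinearMap.fst ℂ weakGraph L2).comp
        (energyEquiv hpos).symm.toContinuousLinearMap))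
  obtain ⟨y, hy⟩ : ∃ y, ∀ a, inner ℂ y (energyEquiv hpos a) = inner ℂ g.2 (a.1 : L2 × L2).1 := by
    refine ⟨(InnerProductSpace.toDual ℂ _).symm F, fun a => ?_⟩
    rw [InnerProductSpace.toDual_symm_apply]
    simp [F]
  obtain ⟨⟨⟨⟨u, d⟩, hu⟩, k⟩, rfl⟩ := (energyEquiv hpos).surjective y
  simp only [inner_energyEquiv, energyInner] at hy
  -- testing with `(0, k)` and with `(φ, 0)` gives the two components of the representing vector
  have hk : k = 0 := by
    have := hy (0, k)
    simpa using this
  have hd : IsWeakDeriv d (weightMul m u - g.2) := by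
    refine isWeakDeriv_iff.2 fun φ => ?_
    have h1 := hy (testToWeakGraph φ, 0)
    have h2 : inner ℂ d (testToL2 (derivTest φ)) + inner ℂ u (weightMul m (testToL2 φ))
      + inner ℂ k (0 : L2) = inner ℂ g.2 (testToL2 φ) := h1
    rw [inner_zero_right, add_zero, ← inner_weightMul_comm, ← eq_sub_iff_add_eq,
      ← inner_sub_left] at h2
    rw [← inner_conj_symm, h2, inner_conj_symm, ← inner_neg_right, neg_sub]
  have hact : KGAction m (⟨u, d, hu⟩, g.1) g :=
    kgAction_iff.2 ⟨rfl, d, _, hu, hd, by simp⟩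
  have hmem := (mem_graph_kgOp hpos).2 ⟨_, _, hact, rfl, rfl⟩
  obtain ⟨x, hx, hx'⟩ := (LinearPMap.mem_graph_iff _).1 hmem
  exact ⟨x, hx'⟩

theorem isSelfAdjoint_kgOp : IsSelfAdjoint (kgOp hpos) :=
  isSelfAdjoint_of_symmetric_of_surjective (dense_domain_kgOp hpos) (kgOp_isFormalAdjoint hpos)
    (kgOp_surjective hpos)

end

/-! ### The embedded eigenvalues -/

theorem hasDerivAt_zeta (x : ℝ) : HasDerivAt zeta (4 * Real.sin x ^ 2) x := by
  have h2 : HasDerivAt (fun x : ℝ => 2 * x) 2 x := by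
    simpa using (hasDerivAt_id x).const_mul (2 : ℝ)
  refine (h2.sub h2.sin).congr_deriv ?_
  rw [Real.cos_two_mul, Real.cos_sq']
  ring

theorem hasDerivAt_one_add_zeta_sq (x : ℝ) :
    HasDerivAt (fun x => 1 + zeta x ^ 2) (8 * zeta x * Real.sin x ^ 2) x := by
  refine (((hasDerivAt_zeta x).pow 2).const_add 1).congr_deriv ?_
  norm_num
  ring

/-- The bound state `ψ(x) = sin x / (1 + ζ(x)²)` of the potential. -/
def boundState (x : ℝ) : ℝ := Real.sin x / (1 + zeta x ^ 2)

/-- The derivative of the bound state. -/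
def boundStateDeriv (x : ℝ) : ℝ :=
  Real.cos x / (1 + zeta x ^ 2) - 8 * zeta x * Real.sin x ^ 3 / (1 + zeta x ^ 2) ^ 2

theorem hasDerivAt_boundState (x : ℝ) : HasDerivAt boundState (boundStateDeriv x) x := by
  have h0 : 1 + zeta x ^ 2 ≠ 0 := by positivity
  refine ((Real.hasDerivAt_sin x).div (hasDerivAt_one_add_zeta_sq x) h0).congr_deriv ?_
  unfold boundStateDeriv
  field_simp

/-- The bound state solves `ψ'' = (V - 1) ψ`. -/
theorem hasDerivAt_boundStateDeriv (x : ℝ) :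
    HasDerivAt boundStateDeriv ((vWN x - 1) * boundState x) x := by
  have h0 : 1 + zeta x ^ 2 ≠ 0 := by positivity
  have hq := hasDerivAt_one_add_zeta_sq x
  refine (((Real.hasDerivAt_cos x).div hq h0).sub
    ((((hasDerivAt_zeta x).const_mul 8).mul ((Real.hasDerivAt_sin x).pow 3)).div
      (hq.pow 2) (pow_ne_zero 2 h0))).congr_deriv ?_
  unfold boundState vWN
  norm_num
  field_simp
  ring

/-- As `ζ(x) = 2x + O(1)`, functions bounded by `(1 + ζ²)⁻¹` decay like `x⁻²`. -/
theorem inv_one_add_zeta_sq_le (x : ℝ) : (1 + zeta x ^ 2)⁻¹ ≤ 2 * (1 + x ^ 2)⁻¹ := by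
  rw [← div_eq_mul_inv, inv_eq_one_div, div_le_div_iff₀ (by positivity) (by positivity)]
  have h1 := Real.neg_one_le_sin (2 * x)
  have h2 := Real.sin_le_one (2 * x)
  unfold zeta
  nlinarith [sq_nonneg (x - Real.sin (2 * x)), sq_nonneg (2 * x - Real.sin (2 * x)),
    sq_nonneg (3 * x - 2 * Real.sin (2 * x))]

theorem memLp_of_abs_le_inv {f : ℝ → ℝ} (hf : Continuous f) {C : ℝ}
    (h : ∀ x, |f x| ≤ C * (1 + zeta x ^ 2)⁻¹) : MemLp (fun x => (f x : ℂ)) 2 volume := by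
  have h1 : MemLp (fun x : ℝ => (1 + x ^ 2)⁻¹) 2 volume := by
    have hc : Continuous fun x : ℝ => (1 + x ^ 2)⁻¹ :=
      Continuous.inv₀ (by fun_prop) fun x => by positivity
    rw [memLp_two_iff_integrable_sq hc.aestronglyMeasurable]
    refine integrable_inv_one_add_sq.mono' (by fun_prop)
      (Filter.Eventually.of_forall fun x => ?_)
    have h0 : 0 ≤ (1 + x ^ 2)⁻¹ := by positivity
    have h1 : (1 + x ^ 2)⁻¹ ≤ 1 := inv_le_one_of_one_le₀ (by nlinarith [sq_nonneg x])
    rw [Real.norm_of_nonneg (by positivity)]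
    nlinarith
  refine h1.of_le_mul (c := C * 2) (by fun_prop) (Filter.Eventually.of_forall fun x => ?_)
  have hC : 0 ≤ C := by
    have := (abs_nonneg _).trans (h x)
    exact nonneg_of_mul_nonneg_left this (by positivity)
  rw [Complex.norm_real, Real.norm_eq_abs, Real.norm_of_nonneg (by positivity), mul_assoc]
  exact (h x).trans (mul_le_mul_of_nonneg_left (inv_one_add_zeta_sq_le x) hC)

theorem continuous_boundState : Continuous boundState :=
  continuous_iff_continuousAt.2 fun x => (hasDerivAt_boundState x).continuousAt

theorem abs_boundState_le (x : ℝ) : |boundState x| ≤ 1 * (1 + zeta x ^ 2)⁻¹ := by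
  unfold boundState
  rw [div_eq_mul_inv, abs_mul, abs_of_nonneg (by positivity : 0 ≤ (1 + zeta x ^ 2)⁻¹)]
  gcongr
  exact Real.abs_sin_le_one x

theorem memLp_boundState : MemLp (fun x => (boundState x : ℂ)) 2 volume :=
  memLp_of_abs_le_inv continuous_boundState abs_boundState_le

theorem memLp_boundStateDeriv : MemLp (fun x => (boundStateDeriv x : ℂ)) 2 volume := by
  refine memLp_of_abs_le_inv (C := 5)
    (continuous_iff_continuousAt.2 fun x => (hasDerivAt_boundStateDeriv x).continuousAt) fun x => ?_
  have hs : |Real.sin x| ^ 3 ≤ 1 := pow_le_one₀ (abs_nonneg _) (Real.abs_sin_le_one x)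
  have hz : 2 * |zeta x| ≤ 1 + zeta x ^ 2 := by
    rw [← sq_abs (zeta x)]; nlinarith [sq_nonneg (|zeta x| - 1)]
  have hq : 0 < 1 + zeta x ^ 2 := by positivity
  have h1 : |Real.cos x / (1 + zeta x ^ 2)| ≤ (1 + zeta x ^ 2)⁻¹ := by
    rw [abs_div, abs_of_pos hq, div_eq_mul_inv]
    exact mul_le_of_le_one_left (by positivity) (Real.abs_cos_le_one x)
  have h2 : |8 * zeta x * Real.sin x ^ 3 / (1 + zeta x ^ 2) ^ 2| ≤ 4 * (1 + zeta x ^ 2)⁻¹ := by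
    rw [abs_div, abs_of_pos (by positivity : 0 < (1 + zeta x ^ 2) ^ 2), ← div_eq_mul_inv,
      div_le_div_iff₀ (by positivity) hq, abs_mul, abs_mul, abs_pow,
      abs_of_pos (by norm_num : (0 : ℝ) < 8)]
    have : 8 * |zeta x| * |Real.sin x| ^ 3 ≤ 4 * (1 + zeta x ^ 2) := by
      nlinarith [abs_nonneg (zeta x)]
    nlinarith
  have := abs_sub (Real.cos x / (1 + zeta x ^ 2))
    (8 * zeta x * Real.sin x ^ 3 / (1 + zeta x ^ 2) ^ 2)
  unfold boundStateDeriv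
  linarith

theorem memLp_boundStateDeriv_deriv :
    MemLp (fun x => (((vWN x - 1) * boundState x : ℝ) : ℂ)) 2 volume := by
  refine memLp_of_abs_le_inv (C := 129)
    ((contDiff_vWN.continuous.sub continuous_const).mul continuous_boundState) fun x => ?_
  rw [abs_mul]
  have h1 : |vWN x - 1| ≤ 129 := (abs_sub _ _).trans (by
    rw [abs_one]; linarith [abs_vWN_le_const x])
  have := abs_boundState_le x
  rw [one_mul] at this
  gcongr

/-- The bound state as an element of `L²(ℝ)`. -/
def boundStateL2 : L2 := memLp_boundState.toLp _

theorem boundStateL2_ne_zero : boundStateL2 ≠ 0 := by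
  intro h
  have h1 : (fun x => (boundState x : ℂ)) =ᵐ[volume] fun _ => 0 :=
    memLp_boundState.coeFn_toLp.symm.trans ((Lp.eq_zero_iff_ae_eq_zero).1 h)
  have h2 := congrFun ((Continuous.ae_eq_iff_eq volume
    (Complex.continuous_ofReal.comp continuous_boundState) continuous_const).1 h1) (Real.pi / 2)
  have h3 : (boundState (Real.pi / 2) : ℂ) = 0 := h2
  rw [Complex.ofReal_eq_zero, boundState, Real.sin_pi_div_two] at h3
  have : (1 : ℝ) / (1 + zeta (Real.pi / 2) ^ 2) ≠ 0 := by positivity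
  exact this h3

/-- Since `l ψ = (1 + m²) ψ` for the bound state `ψ`, the pair `(ψ, E ψ)` is an eigenvector. -/
theorem isEigenvalue_kgOp {m : ℝ} (hpos : EnergyPositive m vWN) {E : ℝ} (hE : E ^ 2 = 1 + m ^ 2) :
    IsEigenvalue (kgOp hpos) (E : ℂ) := by
  have hd := isWeakDeriv_toLp memLp_boundState memLp_boundStateDeriv
    fun x => (hasDerivAt_boundState x).ofReal_comp
  have hw := isWeakDeriv_toLp memLp_boundStateDeriv memLp_boundStateDeriv_deriv
    fun x => (hasDerivAt_boundStateDeriv x).ofReal_comp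
  let ψ : sobolevH1 := ⟨boundStateL2, _, hd⟩
  have hact : KGAction m (ψ, (E : ℂ) • boundStateL2) ((E : ℂ) • (ψ, (E : ℂ) • boundStateL2)) := by
    refine ⟨rfl, _, _, hd, hw, ?_⟩
    filter_upwards [memLp_boundStateDeriv_deriv.coeFn_toLp, memLp_boundState.coeFn_toLp,
      Lp.coeFn_smul ((E : ℂ) * E) boundStateL2] with x h1 h2 h3
    have e : ((E : ℂ) • ((ψ, (E : ℂ) • boundStateL2) : sobolevH1 × L2)).2 =
        ((E : ℂ) * E) • boundStateL2 := smul_smul _ _ _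
    have e2 : (boundStateL2 : ℝ → ℂ) x = boundState x := h2
    have hE' : (E : ℂ) * E = 1 + m ^ 2 := by rw [← sq]; exact_mod_cast congrArg Complex.ofReal hE
    rw [e, h3, Pi.smul_apply, e2, h1, smul_eq_mul, hE']
    push_cast
    ring
  have hmem := (mem_graph_kgOp hpos).2 ⟨_, _, hact, rfl, rfl⟩
  obtain ⟨x, hx, hx'⟩ := (LinearPMap.mem_graph_iff _).1 hmem
  refine ⟨x, ?_, ?_⟩
  · rw [hx, Ne, LinearEquiv.map_eq_zero_iff]
    intro h
    exact boundStateL2_ne_zero (congrArg (fun p : sobolevH1 × L2 => (p.1 : L2)) h)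
  · rw [hx', hx, map_smul]

theorem mem_of_eq_sqrt {m E : ℝ} (hm : 0 < m)
    (hE : E = Real.sqrt (1 + m ^ 2) ∨ E = -Real.sqrt (1 + m ^ 2)) :
    E ∈ Set.Iic (-m) ∪ Set.Ici m ∧ E ^ 2 = 1 + m ^ 2 := by
  have h1 : m ≤ Real.sqrt (1 + m ^ 2) := Real.le_sqrt_of_sq_le (by linarith)
  have h2 : Real.sqrt (1 + m ^ 2) ^ 2 = 1 + m ^ 2 := Real.sq_sqrt (by positivity)
  rcases hE with rfl | rfl
  · exact ⟨Or.inr h1, h2⟩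
  · exact ⟨Or.inl (neg_le_neg h1), by rw [neg_sq, h2]⟩

/-! ### The spectrum contains `(-∞, -m] ∪ [m, ∞)` -/

theorem zeta_ge (x : ℝ) : 2 * x - 1 ≤ zeta x := by
  unfold zeta
  linarith [Real.sin_le_one (2 * x)]

/-- Weyl's criterion: approximate solutions of `l φ = E² φ` yield approximate eigenvectors
`(φ, E φ)` of the Klein-Gordon operator, and these exclude a bounded inverse of `H - E`. -/
theorem mem_spectrumSet_kgOp {m : ℝ} (hpos : EnergyPositive m vWN) {E : ℝ} (hE : E ≠ 0)
    (h : ∀ δ : ℝ, 0 < δ → ∃ φ : TestFn, testToL2 φ ≠ 0 ∧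
      ‖testToL2 (lTest m φ - ((E ^ 2 : ℝ) : ℂ) • φ)‖ ≤ δ * ‖testToL2 φ‖) :
    (E : ℂ) ∈ spectrumSet (kgOp hpos) := by
  rintro ⟨R, -, hR⟩
  obtain ⟨φ, hφ, hr⟩ := h (|E| / (2 * (‖R‖ + 1))) (by positivity)
  set r : TestFn := lTest m φ - ((E ^ 2 : ℝ) : ℂ) • φ with hrdef
  set f : TestFn × TestFn := (φ, (E : ℂ) • φ) with hf
  obtain ⟨x, hx, hx'⟩ := (LinearPMap.mem_graph_iff _).1 (kgOp_extends hpos f)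
  change (x : EnergySpace m hpos) = toEnergy m hpos f at hx
  change kgOp hpos x = toEnergy m hpos (hTest m f) at hx'
  have e1 : kgOp hpos x - (E : ℂ) • (x : EnergySpace m hpos) = toEnergyLinear hpos (0, r) := by
    rw [hx, hx', ← toEnergyLinear_apply, ← toEnergyLinear_apply, ← map_smul, ← map_sub]
    congr 1
    refine Prod.ext (sub_self _) ?_
    change lTest m φ - (E : ℂ) • (E : ℂ) • φ = r
    rw [hrdef, smul_smul, sq, Complex.ofReal_mul]
  have h1 : ‖toEnergyLinear hpos f‖ ≤ ‖R‖ * ‖toEnergyLinear hpos (0, r)‖ := by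
    have := hR x
    rw [e1] at this
    rw [toEnergyLinear_apply hpos f, ← hx, ← this]
    exact R.le_opNorm _
  have h2 : ‖toEnergyLinear hpos (0, r)‖ = ‖testToL2 r‖ := by
    refine (sq_eq_sq₀ (norm_nonneg _) (norm_nonneg _)).1 ?_
    rw [norm_sq_toEnergyLinear, energyInner_self_re]
    simp [testToPair]
  have h3 : |E| * ‖testToL2 φ‖ ≤ ‖toEnergyLinear hpos f‖ := by
    refine le_of_sq_le_sq ?_ (norm_nonneg _)
    have p := norm_sq_toEnergyLinear hpos (φ, 0)
    have p0 := sq_nonneg ‖toEnergyLinear hpos (φ, 0)‖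
    rw [p, energyInner_self_re] at p0
    rw [norm_sq_toEnergyLinear, energyInner_self_re]
    have q : ‖(testToPair f).2‖ ^ 2 = (|E| * ‖testToL2 φ‖) ^ 2 := by
      simp [testToPair, hf, norm_smul]
    have q0 : ‖(testToPair (φ, 0)).2‖ ^ 2 = 0 := by simp [testToPair]
    have q1 : (testToPair f).1 = (testToPair (φ, 0)).1 := rfl
    rw [q, q1]
    linarith
  have h4 : 0 < ‖testToL2 φ‖ := norm_pos_iff.2 hφ
  have h5 : ‖R‖ * ‖testToL2 r‖ ≤ ‖R‖ * (|E| / (2 * (‖R‖ + 1)) * ‖testToL2 φ‖) := by gcongr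
  have h6 : ‖R‖ * (|E| / (2 * (‖R‖ + 1)) * ‖testToL2 φ‖) ≤ |E| * ‖testToL2 φ‖ / 2 := by
    have : ‖R‖ / (‖R‖ + 1) ≤ 1 := by
      rw [div_le_one (by positivity)]; linarith
    calc _ = (‖R‖ / (‖R‖ + 1)) * (|E| * ‖testToL2 φ‖ / 2) := by field_simp
      _ ≤ 1 * (|E| * ‖testToL2 φ‖ / 2) := by gcongr
      _ = _ := one_mul _
  have h7 : 0 < |E| * ‖testToL2 φ‖ := by positivity
  rw [h2] at h1
  linarith

/-- The wave packet `χ((x - c)/n) e^{ikx}`. -/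
def wavePacket (χ : ℝ → ℝ) (h : ContDiff ℝ (⊤ : ℕ∞) χ) (h' : HasCompactSupport χ)
    (k n c : ℝ) (hn : 0 < n) : TestFn :=
  mkTest (fun x => (χ ((x - c) / n) : ℂ) * Complex.exp (Complex.I * k * x))
    (by
      have h1 : ContDiff ℝ (⊤ : ℕ∞) fun x : ℝ => (x : ℂ) := Complex.ofRealCLM.contDiff
      have h2 : ContDiff ℝ (⊤ : ℕ∞) fun x => χ ((x - c) / n) := h.comp (by fun_prop)
      have h3 : ContDiff ℝ (⊤ : ℕ∞) fun x => (χ ((x - c) / n) : ℂ) :=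
        Complex.ofRealCLM.contDiff.comp h2
      exact h3.mul (by fun_prop))
    (by
      let e : ℝ ≃ₜ ℝ := (Homeomorph.subRight c).trans (Homeomorph.mulRight₀ n⁻¹ (by positivity))
      have h1 : HasCompactSupport fun x => χ ((x - c) / n) := h'.comp_homeomorph e
      have h2 : HasCompactSupport fun x => (χ ((x - c) / n) : ℂ) :=
        h1.comp_left (g := fun t : ℝ => (t : ℂ)) (by simp)
      exact h2.mul_right)

theorem hasDerivAt_wave {χ χ' : ℝ → ℂ} (h : ∀ y, HasDerivAt χ (χ' y) y) (k n c : ℝ) (x : ℝ) :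
    HasDerivAt (fun x : ℝ => χ ((x - c) / n) * Complex.exp (Complex.I * k * x))
      ((χ' ((x - c) / n) / n + Complex.I * k * χ ((x - c) / n))
        * Complex.exp (Complex.I * k * x)) x := by
  have h1 : HasDerivAt (fun x : ℝ => (x - c) / n) (1 / n) x :=
    ((hasDerivAt_id x).sub_const c).div_const n
  have h2 := (h ((x - c) / n)).scomp x h1
  have h3 : HasDerivAt (fun x : ℝ => Complex.I * k * (x : ℂ)) (Complex.I * k) x := by
    simpa using (Complex.ofRealCLM.hasDerivAt (x := x)).const_mul (Complex.I * k)
  refine (h2.mul h3.cexp).congr_deriv ?_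
  simp only [Function.comp, Complex.real_smul]
  push_cast
  ring

/-- On a wave packet, `l - (m² + k²)` acts through the derivatives of the envelope and through the
potential only. -/
theorem wavePacket_residual {χ : ℝ → ℝ} (h : ContDiff ℝ (⊤ : ℕ∞) χ) (h' : HasCompactSupport χ)
    (m k n c : ℝ) (hn : 0 < n) (x : ℝ) :
    (lTest m (wavePacket χ h h' k n c hn)
      - ((m ^ 2 + k ^ 2 : ℝ) : ℂ) • wavePacket χ h h' k n c hn : TestFn) x =
      (-((deriv (deriv χ) ((x - c) / n) : ℝ) : ℂ) / n ^ 2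
        - 2 * Complex.I * k * ((deriv χ ((x - c) / n) : ℝ) : ℂ) / n
        + vWN x * (χ ((x - c) / n) : ℂ)) * Complex.exp (Complex.I * k * x) := by
  have hχ := contDiff_infty_iff_deriv.1 h
  have hχ' := contDiff_infty_iff_deriv.1 hχ.2
  have d0 : ∀ y, HasDerivAt (fun y => (χ y : ℂ)) ((deriv χ y : ℝ) : ℂ) y := fun y =>
    (hχ.1 y).hasDerivAt.ofReal_comp
  have d1 : ∀ y, HasDerivAt (fun y => ((deriv χ y : ℝ) : ℂ)) ((deriv (deriv χ) y : ℝ) : ℂ) y := fun y =>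
    (hχ'.1 y).hasDerivAt.ofReal_comp
  have e1 : deriv (wavePacket χ h h' k n c hn) = fun x : ℝ =>
      ((fun y => ((deriv χ y : ℝ) : ℂ) / n + Complex.I * k * χ y) ((x - c) / n))
        * Complex.exp (Complex.I * k * x) :=
    funext fun x => (hasDerivAt_wave d0 k n c x).deriv
  have e2 := (hasDerivAt_wave (fun y => ((d1 y).div_const (n : ℂ)).add
    ((d0 y).const_mul (Complex.I * k))) k n c x).deriv
  change -deriv (deriv (wavePacket χ h h' k n c hn)) x
    + ((m ^ 2 + vWN x : ℝ) : ℂ) * ((χ ((x - c) / n) : ℂ) * Complex.exp (Complex.I * k * x))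
    - ((m ^ 2 + k ^ 2 : ℝ) : ℂ) * ((χ ((x - c) / n) : ℂ) * Complex.exp (Complex.I * k * x)) = _
  rw [e1]
  refine (congrArg (fun t => -t + _ - _) e2).trans ?_
  have hn' : (n : ℂ) ≠ 0 := by exact_mod_cast hn.ne'
  simp only [Pi.add_apply]
  push_cast
  field_simp
  ring_nf
  simp only [Complex.I_sq]
  ring

theorem integral_comp_sub_div (g : ℝ → ℝ) {n : ℝ} (hn : 0 < n) (c : ℝ) :
    ∫ x, g ((x - c) / n) = n * ∫ y, g y := by
  rw [integral_sub_right_eq_self (fun x => g (x / n)) c, Measure.integral_comp_div, abs_of_pos hn,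
    smul_eq_mul]

theorem integrable_sq_of_hasCompactSupport {g : ℝ → ℝ} (hg : Continuous g)
    (hs : HasCompactSupport g) : Integrable fun x => g x ^ 2 := by
  refine Continuous.integrable_of_hasCompactSupport (by fun_prop) ?_
  exact hs.comp_left (g := fun t : ℝ => t ^ 2) (by simp)

/-- Approximate solutions of `l φ = E² φ` for `|E| ≥ m`: slowly modulated plane waves, placed
far out where the potential is small. -/
theorem exists_approx_solution {m E : ℝ} (hE : m ^ 2 ≤ E ^ 2) {δ : ℝ} (hδ : 0 < δ) :
    ∃ φ : TestFn, testToL2 φ ≠ 0 ∧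
      ‖testToL2 (lTest m φ - ((E ^ 2 : ℝ) : ℂ) • φ)‖ ≤ δ * ‖testToL2 φ‖ := by
  obtain ⟨k, hk0, hk⟩ : ∃ k : ℝ, 0 ≤ k ∧ E ^ 2 = m ^ 2 + k ^ 2 :=
    ⟨Real.sqrt (E ^ 2 - m ^ 2), Real.sqrt_nonneg _, by
      rw [Real.sq_sqrt (sub_nonneg.2 hE)]; ring⟩
  let b : ContDiffBump (0 : ℝ) := ⟨1 / 2, 1, by norm_num, by norm_num⟩
  obtain ⟨χ, hχ⟩ : ∃ χ : ℝ → ℝ, χ = b := ⟨_, rfl⟩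
  have hc : ContDiff ℝ (⊤ : ℕ∞) χ := hχ ▸ b.contDiff
  have hs : HasCompactSupport χ := hχ ▸ b.hasCompactSupport
  have hz : ∀ y, 1 ≤ |y| → χ y = 0 := fun y hy => by
    rw [hχ]; exact b.zero_of_le_dist (by simpa using hy)
  have h1 : χ 0 = 1 := by
    rw [hχ]; exact b.one_of_mem_closedBall (by simp [b.rIn_pos.le])
  have hχ' := contDiff_infty_iff_deriv.1 hc
  have hc2 := hχ'.2.continuous_deriv (by simp)
  -- the residual of the packet of width `n` is bounded by `G((x - c)/n) / n`
  let G : ℝ → ℝ := fun y => |deriv (deriv χ) y| + 2 * k * |deriv χ y| + 128 * |χ y|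
  have hG : Continuous G :=
    (hc2.abs.add (continuous_const.mul hχ'.2.continuous.abs)).add
      (continuous_const.mul hc.continuous.abs)
  have hGs : HasCompactSupport G := by
    refine HasCompactSupport.add (HasCompactSupport.add ?_ ?_) ?_
    · exact hs.deriv.deriv.norm
    · exact hs.deriv.norm.mul_left
    · exact hs.norm.mul_left
  have hA : 0 < ∫ y, χ y ^ 2 := by
    refine Continuous.integral_pos_of_hasCompactSupport_nonneg_nonzero (x := 0)
      (by have := hc.continuous; fun_prop) ?_ (fun y => sq_nonneg _) (by simp [h1])
    exact hs.comp_left (g := fun t : ℝ => t ^ 2) (by simp)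
  set A := ∫ y, χ y ^ 2
  set B := ∫ y, G y ^ 2
  obtain ⟨n, hn⟩ := exists_nat_gt (max 2 (B / (A * δ ^ 2)))
  have hn2 : (2 : ℝ) < n := (le_max_left _ _).trans_lt hn
  have hnB : B / (A * δ ^ 2) < n := (le_max_right _ _).trans_lt hn
  have hn0 : (0 : ℝ) < n := by linarith
  -- the packet is supported in `[n² - n, n² + n]`, where `ζ ≥ n`
  let φ := wavePacket χ hc hs k n (n ^ 2) hn0
  have hexp : ∀ x : ℝ, ‖Complex.exp (Complex.I * k * x)‖ = 1 := fun x => by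
    rw [Complex.norm_exp]; simp
  have hφ : ‖testToL2 φ‖ ^ 2 = n * A := by
    rw [norm_sq_testToL2, ← integral_comp_sub_div (fun y => χ y ^ 2) hn0 ((n : ℝ) ^ 2)]
    refine integral_congr_ae (Filter.Eventually.of_forall fun x => ?_)
    change ‖(χ ((x - (n : ℝ) ^ 2) / n) : ℂ) * Complex.exp (Complex.I * k * x)‖ ^ 2 = _
    rw [norm_mul, hexp, mul_one, Complex.norm_real, Real.norm_eq_abs, sq_abs]
  refine ⟨φ, ?_, ?_⟩
  · intro h0
    rw [h0] at hφ
    have : 0 < n * A := by positivity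
    simp at hφ
    rcases hφ with h | h <;> simp_all
  rw [hk]
  set r : TestFn := lTest m φ - ((m ^ 2 + k ^ 2 : ℝ) : ℂ) • φ with hr
  have hrx : ∀ x, ‖r x‖ ≤ G ((x - (n : ℝ) ^ 2) / n) / n := by
    intro x
    rw [hr, wavePacket_residual, norm_mul, hexp, mul_one]
    set y := (x - (n : ℝ) ^ 2) / n with hy
    have a1 : ‖-((deriv (deriv χ) y : ℝ) : ℂ) / (n : ℝ) ^ 2‖ ≤ |deriv (deriv χ) y| / n := by
      rw [norm_div, norm_neg, Complex.norm_real, norm_pow, Complex.norm_real,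
        Real.norm_eq_abs, Real.norm_of_nonneg hn0.le]
      exact div_le_div_of_nonneg_left (abs_nonneg _) hn0 (by nlinarith)
    have a2 : ‖2 * Complex.I * k * ((deriv χ y : ℝ) : ℂ) / (n : ℝ)‖ = 2 * k * |deriv χ y| / n := by
      simp [abs_of_nonneg hk0]
    have a3 : ‖(vWN x : ℂ) * (χ y : ℂ)‖ ≤ 128 * |χ y| / n := by
      rw [norm_mul, Complex.norm_real, Complex.norm_real, Real.norm_eq_abs, Real.norm_eq_abs]
      rcases le_or_gt 1 |y| with h | h
      · simp [hz y h]
      · have hx : (n : ℝ) ^ 2 - n < x := by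
          have h2 := (abs_lt.1 h).1
          rw [hy, lt_div_iff₀ hn0] at h2
          linarith
        have hzeta : (n : ℝ) ≤ |zeta x| := by
          refine le_trans ?_ (le_abs_self _)
          have := zeta_ge x
          nlinarith
        have hV : |vWN x| ≤ 128 / n := by
          rw [le_div_iff₀ hn0]
          exact (mul_le_mul_of_nonneg_left hzeta (abs_nonneg _)).trans
            (abs_vWN_mul_abs_zeta_le x)
        calc _ ≤ 128 / n * |χ y| := by gcongr
          _ = _ := by ring
    refine (norm_add_le _ _).trans ((add_le_add ((norm_sub_le _ _).trans
      (add_le_add a1 a2.le)) a3).trans_eq ?_)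
    simp only [G]
    ring
  have hrn : ‖testToL2 r‖ ^ 2 ≤ B / n := by
    have hi : Integrable fun x => (G ((x - (n : ℝ) ^ 2) / n) / n) ^ 2 := by
      have : Integrable fun y => G y ^ 2 := integrable_sq_of_hasCompactSupport hG hGs
      have := ((this.comp_div hn0.ne').comp_sub_right ((n : ℝ) ^ 2)).div_const ((n : ℝ) ^ 2)
      simpa only [div_pow] using this
    have hir : Integrable fun x => ‖r x‖ ^ 2 :=
      integrable_sq_of_hasCompactSupport r.continuous.norm r.hasCompactSupport.norm
    rw [norm_sq_testToL2]
    refine (integral_mono hir hi fun x => pow_le_pow_left₀ (norm_nonneg _) (hrx x) 2).trans_eq ?_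
    rw [integral_comp_sub_div (fun y => (G y / n) ^ 2) hn0]
    simp only [div_pow]
    rw [integral_div]
    field_simp
    rfl
  refine le_of_sq_le_sq (hrn.trans ?_) (by positivity)
  rw [mul_pow, hφ, div_le_iff₀ hn0]
  rw [div_lt_iff₀ (by positivity)] at hnB
  have h2 : n * (A * δ ^ 2) * 1 ≤ n * (A * δ ^ 2) * n := by
    gcongr
    linarith
  linarith

theorem coe_mem_spectrumSet_kgOp {m : ℝ} (hm : 0 < m) (hpos : EnergyPositive m vWN) {E : ℝ}
    (hE : E ∈ Set.Iic (-m) ∪ Set.Ici m) : (E : ℂ) ∈ spectrumSet (kgOp hpos) := by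
  have h : m ≤ |E| := by
    rcases hE with h | h
    · exact (le_neg.2 h).trans (neg_le_abs E)
    · exact le_trans h (le_abs_self E)
  refine mem_spectrumSet_kgOp hpos (abs_pos.1 (hm.trans_le h)) fun δ hδ =>
    exists_approx_solution ?_ hδ
  rw [← sq_abs E]
  gcongr

/-! ### The form conditions -/

theorem integrable_mul_norm_sq_test {w : ℝ → ℝ} (hw : Continuous w) (f : TestFn) :
    Integrable fun x => w x * ‖f x‖ ^ 2 := by
  refine Continuous.integrable_of_hasCompactSupport (by fun_prop) (HasCompactSupport.mul_left ?_)
  exact f.hasCompactSupport.norm.comp_left (g := fun t : ℝ => t ^ 2) (by simp)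

/-- Condition (I) holds as soon as `m²` exceeds a bound of the potential. -/
theorem wederI_vWN {m : ℝ} (hm : 12 < m) : WederI m vWN := by
  refine ⟨1, one_pos, fun f => ?_⟩
  have h1 : ∫ x, max (-(vWN x)) 0 * ‖f x‖ ^ 2 ≤ ∫ x, 128 * ‖f x‖ ^ 2 := by
    refine integral_mono
      (integrable_mul_norm_sq_test (contDiff_vWN.continuous.neg.max continuous_const) f)
      (integrable_mul_norm_sq_test continuous_const f) fun x => ?_
    have := abs_vWN_le_const x
    have h2 : max (-(vWN x)) 0 ≤ 128 := max_le ((neg_le_abs _).trans this) (by norm_num)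
    exact mul_le_mul_of_nonneg_right h2 (sq_nonneg _)
  have h2 : 0 ≤ ∫ x, ‖f x‖ ^ 2 := by positivity
  have h3 : 0 ≤ ∫ x, ‖deriv f x‖ ^ 2 := by positivity
  rw [integral_const_mul] at h1
  have h4 : 128 * ∫ x, ‖f x‖ ^ 2 ≤ (m ^ 2 - 1) * ∫ x, ‖f x‖ ^ 2 := by
    gcongr
    nlinarith
  linarith

theorem energyPositive_of_wederI {m : ℝ} (h : WederI m vWN) : EnergyPositive m vWN := by
  obtain ⟨ε, hε, h⟩ := h
  refine ⟨ε, hε, fun f => ?_⟩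
  have hV := contDiff_vWN.continuous
  have i1 : Integrable fun x => max (-(vWN x)) 0 * ‖f x‖ ^ 2 :=
    integrable_mul_norm_sq_test (hV.neg.max continuous_const) f
  have i2 := integrable_mul_norm_sq_test (continuous_const (y := m ^ 2)) f
  have h1 : ∫ x, (m ^ 2 * ‖f x‖ ^ 2 - max (-(vWN x)) 0 * ‖f x‖ ^ 2) ≤
      ∫ x, (m ^ 2 + vWN x) * ‖f x‖ ^ 2 := by
    refine integral_mono (i2.sub i1)
      (integrable_mul_norm_sq_test (continuous_const.add hV) f) fun x => ?_
    have h2 : -(vWN x) ≤ max (-(vWN x)) 0 := le_max_left _ _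
    nlinarith [sq_nonneg ‖f x‖]
  rw [integral_sub i2 i1, integral_const_mul] at h1
  linarith [h f]

end KleinGordon

end

open KleinGordon in
theorem theorem2 :
    (∃ m₀ : ℝ, ∀ m : ℝ, m₀ < m → WederI m vWN) ∧
    (∀ m : ℝ, 0 < m → WederI m vWN → EnergyPositive m vWN) ∧
    ∀ (m : ℝ) (_hm : 0 < m) (hpos : EnergyPositive m vWN),
      ∃ J : (sobolevH1 × L2) ≃ₗ[ℂ] EnergySpace m hpos,
        IsEnergyIdentification m hpos J ∧
        ∃ H : EnergySpace m hpos →ₗ.[ℂ] EnergySpace m hpos,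
          -- `H` extends `h`
          (∀ f : TestFn × TestFn, (toEnergy m hpos f, toEnergy m hpos (hTest m f)) ∈ H.graph) ∧
          -- `H` is self-adjoint in the energy space
          IsSelfAdjoint H ∧
          -- the domain of `H` is `H² ⊕ H¹`
          (∀ y, y ∈ H.domain ↔
            ∃ u : sobolevH1 × L2, (u.1 : L2) ∈ sobolevH2 ∧ u.2 ∈ sobolevH1 ∧ J u = y) ∧
          -- `H` acts as the matrix `[[0, 1], [l, 0]]`
          (∀ y z, (y, z) ∈ H.graph ↔
            ∃ u v : sobolevH1 × L2, KGAction m u v ∧ J u = y ∧ J v = z) ∧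
          -- `(-∞, -m] ∪ [m, ∞)` belongs to the spectrum of `H`
          (∀ E : ℝ, E ∈ Set.Iic (-m) ∪ Set.Ici m → (E : ℂ) ∈ spectrumSet H) ∧
          -- the eigenvalues `± √(1 + m²)` are embedded in `(-∞, -m] ∪ [m, ∞)`
          (∀ E : ℝ, E = Real.sqrt (1 + m ^ 2) ∨ E = -Real.sqrt (1 + m ^ 2) →
            E ∈ Set.Iic (-m) ∪ Set.Ici m ∧ IsEigenvalue H (E : ℂ)) := by
  refine ⟨⟨12, fun m hm => wederI_vWN hm⟩, fun m _ h => energyPositive_of_wederI h,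
    fun m hm hpos => ⟨energyIdent hpos, isEnergyIdentification_energyIdent hpos, kgOp hpos,
      kgOp_extends hpos, isSelfAdjoint_kgOp hpos, fun y => mem_domain_kgOp hpos,
      fun y z => mem_graph_kgOp hpos, fun E hE => coe_mem_spectrumSet_kgOp hm hpos hE,
      fun E hE => ?_⟩⟩
  obtain ⟨h1, h2⟩ := mem_of_eq_sqrt hm hE
  exact ⟨h1, isEigenvalue_kgOp hpos h2⟩
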